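/- **Setting.** Fix $d$ distinct sites $s_1,\dots,s_d\in\mathbb R^2$, a partition of them into $K\ge 1$ non-empty regions $\mathcal D_1,\dots,\mathcal D_K$, and thresholds $u_1,\dots,u_d\in\mathbb R$. A replicate consists of outcomes $y=(y_j)_{j\le d}$ and explanatory variables $z=(z(s_j))_{j\le d}$, $z(s_j)\in\mathbb R^q$, of which sub-vectors $z_1,z_2,z_3$ enter the location, scale and shape. The parameter is $\theta=(\omega,\zeta,\beta_1,\beta_2,\beta_3)\in\Theta\subset\mathbb R^p$, with $\Theta$ compact. Put $\mu(s)=z_1(s)^\top\beta_1$, $\sigma(s)=\exp\{z_2(s)^\top\beta_2\}$, $\xi(s)=z_3(s)^\top\beta_3$, $\alpha=2e^\omega/(1+e^\omega)$, $\phi=e^\zeta$, $a_{jl}=\{2(\|s_j-s_l\|/\phi)^{\alpha}\}^{1/2}$, and, with $\Phi$ the standard normal distribution function, $$V(x_1,x_2)=\tfrac1{x_1}\Phi\{\tfrac{a_{jl}}2-\tfrac1{a_{jl}}\log\tfrac{x_1}{x_2}\}+\tfrac1{x_2}\Phi\{\tfrac{a_{jl}}2-\tfrac1{a_{jl}}\log\tfrac{x_2}{x_1}\}$$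 (the Brown–Resnick model). Let $T_j(y)=\{1+\xi(s_j)(y-\mu(s_j))/\sigma(s_j)\}^{1/\xi(s_j)}$ (read as $\exp\{(y-\mu(s_j))/\sigma(s_j)\}$ if $\xi(s_j)=0$) be the transformation of the GEV$(\mu,\sigma,\xi)$ margin to the unit Fréchet scale. For sites $s_j,s_l$ put $x_1=T_j(\max(y_j,u_j))$, $x_2=T_l(\max(y_l,u_l))$. The censored likelihood contribution $g(y_j,y_l;\theta)$ is $\partial_{x_1}\partial_{x_2}e^{-V(x_1,x_2)}\,T_j'(y_j)T_l'(y_l)$ if $y_j>u_j,\ y_l>u_l$; $\partial_{x_1}e^{-V(x_1,x_2)}\,T_j'(y_j)$ if $y_j>u_j,\ y_l\le u_l$; $\partial_{x_2}e^{-V(x_1,x_2)}\,T_l'(y_l)$ if $y_j\le u_j,\ y_l>u_l$; $e^{-V(x_1,x_2)}$ if both outcomes are at or below their thresholds; and $0$ where $\max(y_j,u_j)$ or $\max(y_l,u_l)$ is outside the GEV support. Let $P_\theta$ be the law of one replicate under $\theta$. Under $P_\theta$, $\theta\in\Theta$, the explanatory variables have a law not depending on $\theta$ and, given them, each pair of outcomes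 at two sites of a common region, censored from below at the thresholds, has density $g$ (with respect to the product of the measures "Lebesgue measure above the threshold plus a unit atom at the threshold"). The dependence between regions is otherwise arbitrary. Observe $n$ i.i.d. replicates from $P_{\theta_0}$. Let $\psi_{ik}(\theta)\in\mathbb R^p$ be the gradient in $\theta$ of $\sum\log g(y_{ij},y_{il};\theta)$ over the pairs of distinct sites in $\mathcal D_k$, let $\psi_{i,all}=(\psi_{ik})_{k\le K}$ be the stacked vector, and $$\Psi_k=\tfrac1n\sum_i\psi_{ik},\quad I_k=\nabla_\theta\Psi_k,\quad C=\tfrac1n\sum_i\psi_{i,all}\psi_{i,all}^\top,\quad W_k=\{C^{-1}\}_{k,k},$$ $$i_k(\theta)=E_\theta\{\nabla_\theta\psi_{1k}(\theta)\},\qquad c(\theta)=\mathrm{Var}_\theta\{\psi_{1,all}(\theta)\},$$ where $\{A\}_{k,k'}$ is the $p\times p$ block of $A$ belonging to the regions $k,k'$. **(C1)** (i) There is a set of observations, not depending on $\theta$, that has full $P_\theta$-measure for every $\theta\in\Theta$ and on which all contributions $g$ (for pairs in a common region) are positive for all $\theta\in\Theta$. (ii) On this set the log-likelihoods $\sum\log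 g$ are differentiable with $\psi_{1k}$ twice continuously differentiable, locally around each $\theta\in\Theta$. (iii) $\theta_0$ is an interior point of $\Theta$; for every $k$, $E_{\theta_0}\psi_{1k}(\theta)$ exists for all $\theta\in\Theta$ and vanishes exactly at $\theta=\theta_0$. (iv) $c(\theta)$ is finite and positive definite for all $\theta\in\Theta$. (v) $\nabla\psi_{1k}(\theta_0)$ is $P_{\theta_0}$-integrable, and on the set of (i) the derivative $\nabla^2_\theta\psi_{1k}(\theta)$ is bounded, uniformly in $\theta$ in a neighbourhood of $\theta_0$ and in $k$, by a $P_{\theta_0}$-integrable function of the observation. **(C2)** For every $k$ and every $\delta_n\to\infty$, $$\sup_{\theta\in\Theta,\ \|\theta-\theta_0\|\le\delta_n}\frac{n^{1/2}}{1+n^{1/2}\|\theta-\theta_0\|}\big\|\Psi_k(\theta)-\Psi_k(\theta_0)-E_{\theta_0}\Psi_k(\theta)\big\|=O_p(n^{-1/2}).$$ **Estimators.** Let $\hat\theta_k$ be $\Theta$-valued estimators with $\Psi_k(\hat\theta_k)=0$ with probability tending to one, let $\hat\theta_c=K^{-1}\sum_k\hat\theta_k$, and $$\hat\theta_m=\Big\{\sum_k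 I_k^\top(\hat\theta_c)W_k(\hat\theta_c)I_k(\hat\theta_c)\Big\}^{-1}\sum_k I_k^\top(\hat\theta_c)W_k(\hat\theta_c)I_k(\hat\theta_c)\,\hat\theta_k .$$ **Theorem.** Assume (C1) and (C2), with $d$ (hence $K$ and the sizes of the regions) fixed, and let $n\to\infty$. Then, with probability tending to one, the matrices inverted in $\hat\theta_m$ are nonsingular; $\hat\theta_m\to\theta_0$ in probability; and $$\sqrt n(\hat\theta_m-\theta_0)\xrightarrow{d}\mathcal N\big[0,\ h(\theta_0)^{-1}g(\theta_0)\{h(\theta_0)^\top\}^{-1}\big],$$ where $h(\theta)=\sum_k i_k^\top\{c^{-1}\}_{k,k}i_k$ is nonsingular at $\theta_0$ and $g(\theta)=\sum_{k,k'}i_k^\top\{c^{-1}\}_{k,k}\{c\}_{k,k'}\{c^{-1}\}_{k',k'}i_{k'}$ (with $i_k=i_k(\theta)$, $c=c(\theta)$). The asymptotic covariance of $\hat\theta_m$ is consistently estimated by $J^{-1}(\hat\theta_c)=n^{-1}H(\hat\theta_c)^{-1}G(\hat\theta_c)\{H(\hat\theta_c)^\top\}^{-1}$, where $H=\sum_kI_k^\top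 W_kI_k$ and $G=\sum_{k,k'}I_k^\top W_k\{C\}_{k,k'}W_{k'}I_{k'}$: that is, $nJ^{-1}(\hat\theta_c)\to h(\theta_0)^{-1}g(\theta_0)\{h(\theta_0)^\top\}^{-1}$ in probability. -/

import Mathlib

open MeasureTheory ProbabilityTheory Filter
open scoped Topology ENNReal

noncomputable section

namespace SpatialExtremes

/-! ### The Brown-Resnick pair -/

/-- The standard normal distribution function. -/
def stdNormalCdf (t : ℝ) : ℝ := cdf (gaussianReal 0 1) t

/-- The bivariate exponential measure `V(x₁, x₂)` of the Brown-Resnick process, where `a ^ 2` is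
the variogram `2γ` of the two sites. -/
def exponentMeasure (a x₁ x₂ : ℝ) : ℝ :=
  1 / x₁ * stdNormalCdf (a / 2 - 1 / a * Real.log (x₁ / x₂)) +
    1 / x₂ * stdNormalCdf (a / 2 - 1 / a * Real.log (x₂ / x₁))

/-- The joint distribution function `exp {-V(x₁, x₂)}` (unit Fréchet margins). -/
def frechetPairCdf (a x₁ x₂ : ℝ) : ℝ := Real.exp (-exponentMeasure a x₁ x₂)

/-- The joint density `∂² exp {-V(x₁, x₂)} / (∂x₁ ∂x₂)`. -/
def frechetPairDensity (a x₁ x₂ : ℝ) : ℝ :=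
  deriv (fun t₁ => deriv (fun t₂ => frechetPairCdf a t₁ t₂) x₂) x₁

/-! ### The GEV margins -/

/-- `y` lies in the open support of `GEV(μ, σ, ξ)`. -/
def InGEVSupport (μ σ ξ y : ℝ) : Prop := 0 < 1 + ξ * (y - μ) / σ

/-- The transformation of a `GEV(μ, σ, ξ)` variable to the unit Fréchet scale, that is, the inverse
of `x ↦ μ + σ / ξ * (x ^ ξ - 1)`, which for `ξ = 0` means `x ↦ μ + σ * log x`. -/
def toFrechet (μ σ ξ y : ℝ) : ℝ :=
  if ξ = 0 then Real.exp ((y - μ) / σ) else (1 + ξ * (y - μ) / σ) ^ (1 / ξ)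

/-- The Jacobian of the transformation to the unit Fréchet scale. -/
def frechetJacobian (μ σ ξ y : ℝ) : ℝ := deriv (toFrechet μ σ ξ) y

/-! ### Sites, partition, covariates and parameters -/

/-- `d` sites in the plane, their partition into `K` regions, the thresholds, and the selection of
those of the `q` explanatory variables that enter the location, the log-scale and the shape. -/
structure Design (d K q : ℕ) where
  site : Fin d → EuclideanSpace ℝ (Fin 2)
  site_injective : Function.Injective site
  region : Fin d → Fin K
  region_surjective : Function.Surjective region
  threshold : Fin d → ℝ
  locVars : Finset (Fin q)
  scaleVars : Finset (Fin q)
  shapeVars : Finset (Fin q)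

/-- The explanatory variables of one replicate, at all sites. -/
abbrev Covariates (d q : ℕ) : Type := Fin d → Fin q → ℝ

/-- One replicate: the outcomes and the explanatory variables at all sites. -/
abbrev Obs (d q : ℕ) : Type := (Fin d → ℝ) × Covariates d q

namespace Design

variable {d K q : ℕ} (D : Design d K q)

/-- Coordinates of `θ = (ω, ζ, β₁, β₂, β₃)`. -/
abbrev Idx : Type := Fin 2 ⊕ D.locVars ⊕ D.scaleVars ⊕ D.shapeVars

/-- The parameter space `ℝᵖ` with its Euclidean norm. -/
abbrev Param : Type := EuclideanSpace ℝ D.Idx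

/-- The smoothness `α = 2 exp ω / (1 + exp ω)`. -/
def smoothness (θ : D.Param) : ℝ :=
  2 * Real.exp (θ (Sum.inl 0)) / (1 + Real.exp (θ (Sum.inl 0)))

/-- The range `φ = exp ζ`. -/
def range (θ : D.Param) : ℝ := Real.exp (θ (Sum.inl 1))

/-- The semivariogram `γ(h) = (‖h‖ / φ) ^ α`. -/
def semivariogram (θ : D.Param) (h : EuclideanSpace ℝ (Fin 2)) : ℝ :=
  (‖h‖ / D.range θ) ^ D.smoothness θ

/-- `a_{jl} = {2γ(s_j - s_l)} ^ (1/2)`. -/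
def pairDependence (θ : D.Param) (j l : Fin d) : ℝ :=
  Real.sqrt (2 * D.semivariogram θ (D.site j - D.site l))

/-- The location `z₁ᵀ β₁` at site `j`. -/
def loc (θ : D.Param) (z : Covariates d q) (j : Fin d) : ℝ :=
  ∑ t : D.locVars, z j t * θ (Sum.inr (Sum.inl t))

/-- The scale `exp (z₂ᵀ β₂)` at site `j`. -/
def scale (θ : D.Param) (z : Covariates d q) (j : Fin d) : ℝ :=
  Real.exp (∑ t : D.scaleVars, z j t * θ (Sum.inr (Sum.inr (Sum.inl t))))

/-- The shape `z₃ᵀ β₃` at site `j`. -/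
def shape (θ : D.Param) (z : Covariates d q) (j : Fin d) : ℝ :=
  ∑ t : D.shapeVars, z j t * θ (Sum.inr (Sum.inr (Sum.inr t)))

/-- The outcome at site `j`, censored from below at the threshold of that site. -/
def censor (j : Fin d) (y : ℝ) : ℝ := max y (D.threshold j)

/-- The censored outcome at site `j` lies in the support of its GEV margin. -/
def InSupport (θ : D.Param) (z : Covariates d q) (j : Fin d) (y : ℝ) : Prop :=
  InGEVSupport (D.loc θ z j) (D.scale θ z j) (D.shape θ z j) (D.censor j y)

/-- The censored outcome at site `j` on the unit Fréchet scale. -/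
def frechetValue (θ : D.Param) (z : Covariates d q) (j : Fin d) (y : ℝ) : ℝ :=
  toFrechet (D.loc θ z j) (D.scale θ z j) (D.shape θ z j) (D.censor j y)

/-- The Jacobian at the censored outcome at site `j`. -/
def jacobian (θ : D.Param) (z : Covariates d q) (j : Fin d) (y : ℝ) : ℝ :=
  frechetJacobian (D.loc θ z j) (D.scale θ z j) (D.shape θ z j) (D.censor j y)

open Classical in
/-- The censored likelihood contribution `g(y₁, y₂; θ, u)` of the outcomes at the sites `j, l`
(it vanishes outside the support of the margins). -/
def pairLikelihood (θ : D.Param) (z : Covariates d q) (j l : Fin d) (y₁ y₂ : ℝ) : ℝ :=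
  if D.InSupport θ z j y₁ ∧ D.InSupport θ z l y₂ then
    if D.threshold j < y₁ then
      if D.threshold l < y₂ then
        frechetPairDensity (D.pairDependence θ j l)
            (D.frechetValue θ z j y₁) (D.frechetValue θ z l y₂)
          * D.jacobian θ z j y₁ * D.jacobian θ z l y₂
      else
        deriv (fun t => frechetPairCdf (D.pairDependence θ j l) t (D.frechetValue θ z l y₂))
            (D.frechetValue θ z j y₁)
          * D.jacobian θ z j y₁
    else
      if D.threshold l < y₂ then
        deriv (fun t => frechetPairCdf (D.pairDependence θ j l) (D.frechetValue θ z j y₁) t)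
            (D.frechetValue θ z l y₂)
          * D.jacobian θ z l y₂
      else
        frechetPairCdf (D.pairDependence θ j l)
          (D.frechetValue θ z j y₁) (D.frechetValue θ z l y₂)
  else 0

/-- The (unordered) pairs of distinct sites in the region `k`. -/
def pairs (k : Fin K) : Finset (Fin d × Fin d) :=
  {e | e.1 < e.2 ∧ D.region e.1 = k ∧ D.region e.2 = k}

/-- The contribution of one replicate to the log censored composite likelihood of region `k`. -/
def logLikelihood (k : Fin K) (o : Obs d q) (θ : D.Param) : ℝ :=
  ∑ e ∈ D.pairs k, Real.log (D.pairLikelihood θ o.2 e.1 e.2 (o.1 e.1) (o.1 e.2))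

/-- The censored composite score kernel `ψ_{ik}(θ)` of one replicate. -/
def score (k : Fin K) (o : Obs d q) (θ : D.Param) : D.Param :=
  gradient (D.logLikelihood k o) θ

/-- The Jacobian matrix `∇ F(θ)`, with entries `∂ F_a / ∂ θ_b`. -/
def jacobianMatrix (F : D.Param → D.Param) (θ : D.Param) : Matrix D.Idx D.Idx ℝ :=
  Matrix.of fun a b => fderiv ℝ F θ (EuclideanSpace.single b 1) a

/-- The block `(A)_{k,k'}` of a matrix whose rows and columns are stacked over the regions. -/
def block (A : Matrix (Fin K × D.Idx) (Fin K × D.Idx) ℝ) (k k' : Fin K) :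
    Matrix D.Idx D.Idx ℝ :=
  A.submatrix (Prod.mk k) (Prod.mk k')

/-! ### Sample quantities, based on the first `n` replicates -/

/-- The censored composite score function `Ψ_k(θ)`. -/
def meanScore (k : Fin K) (n : ℕ) (x : ℕ → Obs d q) (θ : D.Param) : D.Param :=
  (n : ℝ)⁻¹ • ∑ i ∈ Finset.range n, D.score k (x i) θ

/-- The sample sensitivity `I_k(θ) = ∇ Ψ_k(θ)`. -/
def sampleSensitivity (k : Fin K) (n : ℕ) (x : ℕ → Obs d q) (θ : D.Param) :
    Matrix D.Idx D.Idx ℝ :=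
  D.jacobianMatrix (D.meanScore k n x) θ

/-- The sample covariance `C(θ)` of the stacked scores. -/
def sampleVariability (n : ℕ) (x : ℕ → Obs d q) (θ : D.Param) :
    Matrix (Fin K × D.Idx) (Fin K × D.Idx) ℝ :=
  Matrix.of fun a b =>
    (n : ℝ)⁻¹ * ∑ i ∈ Finset.range n, D.score a.1 (x i) θ a.2 * D.score b.1 (x i) θ b.2

/-- The weight `W_k(θ) = {C⁻¹(θ)}_{k,k}`. -/
def weight (k : Fin K) (n : ℕ) (x : ℕ → Obs d q) (θ : D.Param) : Matrix D.Idx D.Idx ℝ :=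
  D.block (D.sampleVariability n x θ)⁻¹ k k

/-- `H(θ) = ∑_k I_kᵀ W_k I_k`. -/
def bread (n : ℕ) (x : ℕ → Obs d q) (θ : D.Param) : Matrix D.Idx D.Idx ℝ :=
  ∑ k, (D.sampleSensitivity k n x θ).transpose * D.weight k n x θ * D.sampleSensitivity k n x θ

/-- `G(θ) = ∑_{k,k'} I_kᵀ W_k C_{k,k'} W_{k'} I_{k'}`. -/
def meat (n : ℕ) (x : ℕ → Obs d q) (θ : D.Param) : Matrix D.Idx D.Idx ℝ :=
  ∑ k, ∑ k', (D.sampleSensitivity k n x θ).transpose * D.weight k n x θ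
    * D.block (D.sampleVariability n x θ) k k'
    * D.weight k' n x θ * D.sampleSensitivity k' n x θ

/-- `J⁻¹(θ) = n⁻¹ H⁻¹(θ) G(θ) {Hᵀ(θ)}⁻¹`. -/
def covEstimate (n : ℕ) (x : ℕ → Obs d q) (θ : D.Param) : Matrix D.Idx D.Idx ℝ :=
  (n : ℝ)⁻¹ • ((D.bread n x θ)⁻¹ * D.meat n x θ * ((D.bread n x θ).transpose)⁻¹)

/-- The average of the regional estimates. -/
def averageEstimate (t : Fin K → D.Param) : D.Param := (K : ℝ)⁻¹ • ∑ k, t k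

/-- The closed-form meta-estimate computed from the regional estimates `t`. -/
def metaEstimate (n : ℕ) (x : ℕ → Obs d q) (t : Fin K → D.Param) : D.Param :=
  WithLp.toLp 2 ((D.bread n x (D.averageEstimate t))⁻¹.mulVec
    (∑ k, ((D.sampleSensitivity k n x (D.averageEstimate t)).transpose
        * D.weight k n x (D.averageEstimate t)
        * D.sampleSensitivity k n x (D.averageEstimate t)).mulVec (t k)))

/-! ### Population quantities; `law θ` is the law of one replicate under `θ` -/

variable (law : D.Param → Measure (Obs d q))

/-- The sensitivity `i_k(θ) = E_θ {∇ ψ_k(θ)}`. -/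
def sensitivity (k : Fin K) (θ : D.Param) : Matrix D.Idx D.Idx ℝ :=
  Matrix.of fun a b => ∫ o, D.jacobianMatrix (D.score k o) θ a b ∂(law θ)

/-- The variability `c(θ)`: the covariance under `θ` of the stacked score of one replicate, which
is that of `√n` times the stacked mean score of `n` independent replicates. -/
def variability (θ : D.Param) : Matrix (Fin K × D.Idx) (Fin K × D.Idx) ℝ :=
  Matrix.of fun a b => cov[fun o => D.score a.1 o θ a.2, fun o => D.score b.1 o θ b.2; law θ]

/-- `h(θ) = ∑_k i_kᵀ {c⁻¹}_{k,k} i_k`. -/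
def asympBread (θ : D.Param) : Matrix D.Idx D.Idx ℝ :=
  ∑ k, (D.sensitivity law k θ).transpose * D.block (D.variability law θ)⁻¹ k k
    * D.sensitivity law k θ

/-- `g(θ) = ∑_{k,k'} i_kᵀ {c⁻¹}_{k,k} c_{k,k'} {c⁻¹}_{k',k'} i_{k'}`. -/
def asympMeat (θ : D.Param) : Matrix D.Idx D.Idx ℝ :=
  ∑ k, ∑ k', (D.sensitivity law k θ).transpose * D.block (D.variability law θ)⁻¹ k k
    * D.block (D.variability law θ) k k'
    * D.block (D.variability law θ)⁻¹ k' k' * D.sensitivity law k' θ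

/-- `h⁻¹ g (hᵀ)⁻¹`. -/
def asympCov (θ : D.Param) : Matrix D.Idx D.Idx ℝ :=
  (D.asympBread law θ)⁻¹ * D.asympMeat law θ * ((D.asympBread law θ).transpose)⁻¹

/-! ### Model and regularity conditions -/

/-- The reference measure of a censored outcome at site `j`: Lebesgue measure above the threshold
and a unit atom at the threshold. -/
def censoredVolume (j : Fin d) : Measure ℝ :=
  (volume : Measure ℝ).restrict (Set.Ioi (D.threshold j)) + Measure.dirac (D.threshold j)

/-- The reference measure of the covariates and a censored pair. -/
def pairVolume (covLaw : Measure (Covariates d q)) (j l : Fin d) :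
    Measure (Covariates d q × ℝ × ℝ) :=
  covLaw.prod ((D.censoredVolume j).prod (D.censoredVolume l))

/-- The model, for parameters in `Θ`: the covariates have a law `covLaw` that does not depend on the
parameter and, given the covariates, each pair of outcomes in a common region, censored at the
thresholds, follows the bivariate max-stable model. -/
structure IsModel (Θ : Set D.Param) (covLaw : Measure (Covariates d q)) : Prop where
  prob : ∀ θ ∈ Θ, IsProbabilityMeasure (law θ)
  covariates : ∀ θ ∈ Θ, (law θ).map Prod.snd = covLaw
  measurable_density : ∀ θ ∈ Θ, ∀ k, ∀ e ∈ D.pairs k,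
    AEMeasurable (fun w : Covariates d q × ℝ × ℝ =>
      D.pairLikelihood θ w.1 e.1 e.2 w.2.1 w.2.2) (D.pairVolume covLaw e.1 e.2)
  density : ∀ θ ∈ Θ, ∀ k, ∀ e ∈ D.pairs k,
    (law θ).map (fun o => (o.2, D.censor e.1 (o.1 e.1), D.censor e.2 (o.1 e.2))) =
      (D.pairVolume covLaw e.1 e.2).withDensity
        (fun w => ENNReal.ofReal (D.pairLikelihood θ w.1 e.1 e.2 w.2.1 w.2.2))

/-- Regularity condition (C1), with `supp` the common support of the observations. -/
structure ConditionC1 (Θ : Set D.Param) (supp : Set (Obs d q)) (θ₀ : D.Param) : Prop where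
  support_full : ∀ θ ∈ Θ, law θ suppᶜ = 0
  support_pos : ∀ o ∈ supp, ∀ θ ∈ Θ, ∀ k, ∀ e ∈ D.pairs k,
    0 < D.pairLikelihood θ o.2 e.1 e.2 (o.1 e.1) (o.1 e.2)
  /-- The score, which is the gradient of `logLikelihood`, is twice continuously differentiable. -/
  smooth : ∀ o ∈ supp, ∀ θ ∈ Θ, ∀ k, ContDiffAt ℝ 3 (D.logLikelihood k o) θ
  interior : θ₀ ∈ interior Θ
  integrable_score : ∀ θ ∈ Θ, ∀ k, Integrable (fun o => D.score k o θ) (law θ₀)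
  unique_zero : ∀ k, ∀ θ ∈ Θ, ∫ o, D.score k o θ ∂(law θ₀) = 0 ↔ θ = θ₀
  variability_finite : ∀ θ ∈ Θ, ∀ k, MemLp (fun o => D.score k o θ) 2 (law θ)
  variability_posDef : ∀ θ ∈ Θ, (D.variability law θ).PosDef
  sensitivity_finite : ∀ k, Integrable (fun o => fderiv ℝ (D.score k o) θ₀) (law θ₀)
  /-- The first derivative of the sensitivity is bounded, uniformly near `θ₀`, by an integrable
  function of the observation. -/
  sensitivity_deriv_bounded : ∃ r > 0, ∃ b : Obs d q → ℝ, Integrable b (law θ₀) ∧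
    ∀ o ∈ supp, ∀ θ ∈ Metric.ball θ₀ r, ∀ k, ‖iteratedFDeriv ℝ 2 (D.score k o) θ‖ ≤ b o

end Design

/-- `X_n = O_p(r_n)`. -/
def IsBigOInProb {Ω : Type*} [MeasurableSpace Ω] (P : Measure Ω) (X : ℕ → Ω → ℝ≥0∞)
    (r : ℕ → ℝ) : Prop :=
  ∀ ε : ℝ≥0∞, 0 < ε → ∃ M : ℝ, 0 < M ∧
    ∀ᶠ n in atTop, P {ω | ENNReal.ofReal (M * r n) < X n ω} ≤ ε

/-- Regularity condition (C2): for every `δ_n → ∞`, the supremum over `θ ∈ Θ` with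
`‖θ - θ₀‖ ≤ δ_n` of `√n / (1 + √n ‖θ - θ₀‖) ‖Ψ_k(θ) - Ψ_k(θ₀) - E_{θ₀} Ψ_k(θ)‖` is
`O_p(n^{-1/2})`. -/
def Design.ConditionC2 {d K q : ℕ} (D : Design d K q) (law : D.Param → Measure (Obs d q))
    (Θ : Set D.Param) (θ₀ : D.Param) {Ω : Type*} [MeasurableSpace Ω] (P : Measure Ω)
    (O : ℕ → Ω → Obs d q) : Prop :=
  ∀ δ : ℕ → ℝ, Tendsto δ atTop atTop → ∀ k,
    IsBigOInProb P
      (fun n ω => ⨆ θ ∈ {θ | θ ∈ Θ ∧ ‖θ - θ₀‖ ≤ δ n},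
        ENNReal.ofReal (√(n : ℝ) / (1 + √(n : ℝ) * ‖θ - θ₀‖) *
          ‖D.meanScore k n (fun i => O i ω) θ - D.meanScore k n (fun i => O i ω) θ₀
            - ∫ o, D.score k o θ ∂(law θ₀)‖))
      (fun n => (√(n : ℝ))⁻¹)

end SpatialExtremes

end

open SpatialExtremes

/-! The regional estimators are Z-estimators. Linearizing each score equation at its root gives `√n
(A_k (θ̂_k - θ₀) + Ψ_k(θ₀)) → 0` in probability, with `A_k` the expected derivative of the score.
The meta-estimator is a matrix-weighted mean of the `θ̂_k` whose weights sum to the identity, so its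
error is the same weighted mean of the regional errors. In the limit the weight of region `k` is
`h⁻¹ i_kᵀ {c⁻¹}_{k,k} i_k`; its last factor `i_k` is the matrix of `A_k`, and the linearization
turns the error into a fixed linear image of the stacked mean score. The central limit theorem and
Slutsky's lemma conclude.

Three points are not immediate from the conditions.

Invertibility of `A_k` is not assumed. `IsModel.inner_integral_fderiv_score_neg` derives it from the
likelihood structure. Each pair is a genuine model, so its likelihood ratio against `θ₀` has
expectation at most one, and by Jensen so has the geometric mean over the `m` pairs of a region.
Expanding along a ray `θ₀ + s v` and applying Fatou to the nonnegative function `exp x - 1 - x`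
gives `E⟪ψ, v⟫² / (4 m²) ≤ -⟪A_k v, v⟫ / (2 m)`. This weak form of the information identity needs no
differentiation under the integral of the density. As `c(θ₀)` is positive definite, the left side is
positive for `v ≠ 0`.

Consistency and the rate come from (C2). On the compact `Θ` it is a uniform law of large numbers,
which also makes the expected score continuous; its unique zero then attracts the roots
(`ConditionC1.tendsto_estimator`). The weight in (C2) and the lower bound `c ‖v‖ ≤ ‖A_k v‖` upgrade
this to the root-`n` rate (`ConditionC1.tightEvents_estimator`).

Consistency of the sample variability at the average estimate is delicate because the Lipschitz
modulus of the scores is only known to be integrable, not square-integrable. The root-`n` rate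
compensates: the squared moduli enter with an extra factor `1/n`, and `n⁻² ∑ m_i² → 0` almost surely
(`ConditionC1.tendsto_sampleVariability`, `tendsto_mean_sq_div`). -/

namespace SpatialExtremes

/-! ### Convergence and boundedness in probability. -/

section InProbability

variable {Ω : Type*} [MeasurableSpace Ω] {P : Measure Ω}

/-- The filter on `ℕ × Ω` of the events that hold with probability tending to one. Convergence in
probability of `X n ω` to a constant is convergence of the uncurried `X` along this filter. -/
def inProb (P : Measure Ω) : Filter (ℕ × Ω) where
  sets := {S | Tendsto (fun n => P {ω | (n, ω) ∉ S}) atTop (𝓝 0)}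
  univ_sets := by simp
  sets_of_superset := by
    intro S T hS hST
    refine tendsto_of_tendsto_of_tendsto_of_le_of_le tendsto_const_nhds hS (fun _ => zero_le) ?_
    exact fun n => measure_mono fun ω hω hS' => hω (hST hS')
  inter_sets := by
    intro S T hS hT
    have hS' : Tendsto (fun n => P {ω | (n, ω) ∉ S}) atTop (𝓝 0) := hS
    have hT' : Tendsto (fun n => P {ω | (n, ω) ∉ T}) atTop (𝓝 0) := hT
    have hST := hS'.add hT'
    rw [add_zero] at hST
    refine tendsto_of_tendsto_of_tendsto_of_le_of_le tendsto_const_nhds hST (fun _ => zero_le) ?_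
    intro n
    refine (measure_mono ?_).trans (measure_union_le _ _)
    intro ω hω
    by_contra h
    simp only [Set.mem_union, Set.mem_ofPred_eq, not_or, not_not] at h
    exact hω h

lemma eventually_inProb {p : ℕ × Ω → Prop} :
    (∀ᶠ x in inProb P, p x) ↔ Tendsto (fun n => P {ω | ¬ p (n, ω)}) atTop (𝓝 0) := Iff.rfl

lemma eventually_inProb_of_ae {p : Ω → Prop} (h : ∀ᵐ ω ∂P, p ω) :
    ∀ᶠ x in inProb P, p x.2 := by
  rw [eventually_inProb]
  simp [ae_iff.1 h]

lemma tendsto_fst_inProb : Tendsto Prod.fst (inProb P) atTop := by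
  intro s hs
  change ∀ᶠ x in inProb P, x.1 ∈ s
  rw [eventually_inProb]
  refine tendsto_const_nhds.congr' ?_
  filter_upwards [hs] with n hn
  simp [show n ∈ s from hn]

/-- Events with probability tending to one are eventually nonempty, so a sample with a prescribed
likely property can be picked. -/
instance [IsProbabilityMeasure P] : (inProb P).NeBot := by
  refine ⟨fun h => ?_⟩
  have h0 : ∀ᶠ x in inProb P, False := by rw [h]; exact eventually_bot
  rw [eventually_inProb] at h0
  simp only [not_false_eq_true, Set.ofPred_true, measure_univ] at h0
  exact one_ne_zero (tendsto_nhds_unique tendsto_const_nhds h0)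

lemma tendstoInMeasure_iff_inProb {E : Type*} [PseudoMetricSpace E] {X : ℕ → Ω → E} {a : E} :
    TendstoInMeasure P X atTop (fun _ => a) ↔
      Tendsto (fun x : ℕ × Ω => X x.1 x.2) (inProb P) (𝓝 a) := by
  rw [tendstoInMeasure_iff_dist, Metric.tendsto_nhds]
  simp only [eventually_inProb, not_lt]

lemma tendsto_inProb_of_ae [IsFiniteMeasure P] {E : Type*} [PseudoMetricSpace E] {X : ℕ → Ω → E}
    {a : E} (hX : ∀ n, AEStronglyMeasurable (X n) P)
    (h : ∀ᵐ ω ∂P, Tendsto (fun n => X n ω) atTop (𝓝 a)) :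
    Tendsto (fun x : ℕ × Ω => X x.1 x.2) (inProb P) (𝓝 a) :=
  tendstoInMeasure_iff_inProb.1 (tendstoInMeasure_of_tendsto_ae hX h)

/-- For every `ε` there is an index `a` such that the event `G a` has probability at least
`1 - ε` in the limit; with `G M x = (X x ≤ M)` this says `X = O_p(1)`. -/
def TightEvents {α : Type*} (P : Measure Ω) (G : α → ℕ × Ω → Prop) : Prop :=
  ∀ ε : ℝ≥0∞, 0 < ε → ∃ a, ∀ᶠ n in atTop, P {ω | ¬ G a (n, ω)} ≤ ε

namespace TightEvents

variable {α β : Type*} {G : α → ℕ × Ω → Prop} {G' : β → ℕ × Ω → Prop}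

/-- To show that an event is likely one may fix a bound on the tight quantities: half of `ε` pays
for leaving `G a`, the other half for the failure of `p` on `G a`. -/
lemma eventually (hG : TightEvents P G) {p : ℕ × Ω → Prop}
    (h : ∀ a, ∀ᶠ x in inProb P, G a x → p x) : ∀ᶠ x in inProb P, p x := by
  rw [eventually_inProb, ENNReal.tendsto_nhds_zero]
  intro ε hε
  obtain ⟨a, ha⟩ := hG (ε / 2) (ENNReal.half_pos hε.ne')
  have h1 := ENNReal.tendsto_nhds_zero.1 (eventually_inProb.1 (h a)) (ε / 2)
    (ENNReal.half_pos hε.ne')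
  filter_upwards [ha, h1] with n hn hn1
  calc P {ω | ¬ p (n, ω)} ≤ P ({ω | ¬ G a (n, ω)} ∪ {ω | ¬ (G a (n, ω) → p (n, ω))}) := by
        refine measure_mono fun ω hω => ?_
        by_cases hg : G a (n, ω)
        · exact Or.inr fun h => hω (h hg)
        · exact Or.inl hg
    _ ≤ ε / 2 + ε / 2 := (measure_union_le _ _).trans (add_le_add hn hn1)
    _ = ε := ENNReal.add_halves ε

/-- The new bound `b` may depend on the old bound `a`, and the implication need only hold with
probability tending to one. -/
lemma mono (hG : TightEvents P G) (h : ∀ a, ∃ b, ∀ᶠ x in inProb P, G a x → G' b x) :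
    TightEvents P G' := by
  intro ε hε
  obtain ⟨a, ha⟩ := hG (ε / 2) (ENNReal.half_pos hε.ne')
  obtain ⟨b, hb⟩ := h a
  have h1 := ENNReal.tendsto_nhds_zero.1 (eventually_inProb.1 hb) (ε / 2)
    (ENNReal.half_pos hε.ne')
  refine ⟨b, ?_⟩
  filter_upwards [ha, h1] with n hn hn1
  calc P {ω | ¬ G' b (n, ω)} ≤ P ({ω | ¬ G a (n, ω)} ∪ {ω | ¬ (G a (n, ω) → G' b (n, ω))}) := by
        refine measure_mono fun ω hω => ?_
        by_cases hg : G a (n, ω)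
        · exact Or.inr fun h => hω (h hg)
        · exact Or.inl hg
    _ ≤ ε / 2 + ε / 2 := (measure_union_le _ _).trans (add_le_add hn hn1)
    _ = ε := ENNReal.add_halves ε

lemma and (hG : TightEvents P G) (hG' : TightEvents P G') :
    TightEvents P (fun (c : α × β) x => G c.1 x ∧ G' c.2 x) := by
  intro ε hε
  obtain ⟨a, ha⟩ := hG (ε / 2) (ENNReal.half_pos hε.ne')
  obtain ⟨b, hb⟩ := hG' (ε / 2) (ENNReal.half_pos hε.ne')
  refine ⟨(a, b), ?_⟩
  filter_upwards [ha, hb] with n hn hn1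
  calc P {ω | ¬ (G a (n, ω) ∧ G' b (n, ω))}
        ≤ P ({ω | ¬ G a (n, ω)} ∪ {ω | ¬ G' b (n, ω)}) := by
        refine measure_mono fun ω hω => ?_
        exact not_and_or.1 hω
    _ ≤ ε / 2 + ε / 2 := (measure_union_le _ _).trans (add_le_add hn hn1)
    _ = ε := ENNReal.add_halves ε

lemma finset_forall {ι : Type*} {G : ι → α → ℕ × Ω → Prop} [Nonempty α] (s : Finset ι)
    (h : ∀ i, TightEvents P (G i)) :
    TightEvents P (fun (a : ι → α) x => ∀ i ∈ s, G i (a i) x) := by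
  classical
  induction s using Finset.induction_on with
  | empty => intro ε _; exact ⟨fun _ => Classical.arbitrary α, by simp⟩
  | insert i s his ih =>
    refine ((h i).and ih).mono fun c => ⟨fun j => if j = i then c.1 else c.2 j, ?_⟩
    refine Eventually.of_forall fun x hx j hj => ?_
    by_cases hji : j = i
    · subst hji; simpa using hx.1
    · simpa [hji] using hx.2 j ((Finset.mem_insert.1 hj).resolve_left hji)

lemma fintype_forall {ι : Type*} [Fintype ι] {G : ι → α → ℕ × Ω → Prop} [Nonempty α]
    (h : ∀ i, TightEvents P (G i)) :
    TightEvents P (fun (a : ι → α) x => ∀ i, G i (a i) x) :=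
  (finset_forall Finset.univ h).mono fun a =>
    ⟨a, Eventually.of_forall fun _ hx i => hx i (Finset.mem_univ i)⟩

end TightEvents

/-- The sum of tight variables is tight. -/
lemma TightEvents.le_sum {ι : Type*} [Fintype ι] {X : ι → ℕ × Ω → ℝ} {Y : ℕ × Ω → ℝ}
    (h : ∀ i, TightEvents P (fun (M : ℝ) x => X i x ≤ M)) (hY : ∀ x, Y x ≤ ∑ i, X i x) :
    TightEvents P (fun (M : ℝ) x => Y x ≤ M) :=
  (TightEvents.fintype_forall h).mono fun M => ⟨∑ i, M i, Eventually.of_forall fun x hx =>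
    (hY x).trans (Finset.sum_le_sum fun i _ => hx i)⟩

/-- `O_p(1) o_p(1) = o_p(1)`. -/
lemma TightEvents.tendsto_zero_of_norm_le {E : Type*} [SeminormedAddCommGroup E]
    {X Y : ℕ × Ω → ℝ} {Z : ℕ × Ω → E}
    (hX : TightEvents P (fun (M : ℝ) x => |X x| ≤ M)) (hY : Tendsto Y (inProb P) (𝓝 0))
    (hZ : ∀ᶠ x in inProb P, ‖Z x‖ ≤ |X x| * |Y x|) : Tendsto Z (inProb P) (𝓝 0) := by
  rw [Metric.tendsto_nhds]
  intro ε hε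
  refine hX.eventually fun M => ?_
  have h1 : Tendsto (fun x => |M| * |Y x|) (inProb P) (𝓝 0) := by
    simpa using (hY.abs).const_mul |M|
  filter_upwards [hZ, h1.eventually_lt_const hε] with x hx hx1 hx2
  rw [dist_zero_right]
  refine (hx.trans ?_).trans_lt hx1
  exact mul_le_mul_of_nonneg_right (hx2.trans (le_abs_self M)) (abs_nonneg _)

end InProbability


/-! ### Laws of large numbers, root-n bounds and the central limit theorem for functions of the
replicates. -/

section IndependentReplicates

variable {Ω : Type*} [MeasurableSpace Ω] {P : Measure Ω}
  {S : Type*} [MeasurableSpace S] {μ : Measure S} {O : ℕ → Ω → S}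

lemma iIndepFun_comp_of_hasLaw (hindep : iIndepFun O P) (hlaw : ∀ i, HasLaw (O i) μ P)
    {E : Type*} [MeasurableSpace E] {F : S → E} (hF : AEMeasurable F μ) :
    iIndepFun (fun i ω => F (O i ω)) P :=
  hindep.comp₀ (fun _ => F) (fun i => (hlaw i).aemeasurable)
    (fun i => by rw [(hlaw i).map_eq]; exact hF)

lemma hasLaw_comp (hlaw : ∀ i, HasLaw (O i) μ P) {E : Type*} [MeasurableSpace E] {F : S → E}
    (hF : AEMeasurable F μ) (i : ℕ) : HasLaw (fun ω => F (O i ω)) (μ.map F) P :=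
  HasLaw.comp ⟨hF, rfl⟩ (hlaw i)

lemma identDistrib_comp (hlaw : ∀ i, HasLaw (O i) μ P) {E : Type*} [MeasurableSpace E] {F : S → E}
    (hF : AEMeasurable F μ) (i : ℕ) :
    IdentDistrib (fun ω => F (O i ω)) (fun ω => F (O 0 ω)) P P where
  aemeasurable_fst := (hasLaw_comp hlaw hF i).aemeasurable
  aemeasurable_snd := (hasLaw_comp hlaw hF 0).aemeasurable
  map_eq := by rw [(hasLaw_comp hlaw hF i).map_eq, (hasLaw_comp hlaw hF 0).map_eq]

lemma ae_comp_of_hasLaw (hlaw : ∀ i, HasLaw (O i) μ P) {p : S → Prop} (h : ∀ᵐ o ∂μ, p o) :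
    ∀ᵐ ω ∂P, ∀ i, p (O i ω) := by
  rw [ae_all_iff]
  intro i
  rw [← (hlaw i).map_eq] at h
  exact ae_of_ae_map (hlaw i).aemeasurable h

lemma aestronglyMeasurable_mean (hlaw : ∀ i, HasLaw (O i) μ P)
    {E : Type*} [NormedAddCommGroup E] [NormedSpace ℝ E] {F : S → E}
    (hF : AEStronglyMeasurable F μ) (n : ℕ) :
    AEStronglyMeasurable (fun ω => (n : ℝ)⁻¹ • ∑ i ∈ Finset.range n, F (O i ω)) P := by
  refine AEStronglyMeasurable.const_smul ?_ _
  refine Finset.aestronglyMeasurable_fun_sum _ fun i _ => ?_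
  refine AEStronglyMeasurable.comp_aemeasurable ?_ (hlaw i).aemeasurable
  rwa [(hlaw i).map_eq]

/-- The strong law of large numbers for a function of the replicates. -/
lemma tendsto_mean_ae (hindep : iIndepFun O P) (hlaw : ∀ i, HasLaw (O i) μ P)
    {E : Type*} [NormedAddCommGroup E] [NormedSpace ℝ E] [CompleteSpace E]
    [SecondCountableTopology E] {F : S → E} (hF : Integrable F μ) :
    ∀ᵐ ω ∂P, Tendsto (fun n : ℕ => (n : ℝ)⁻¹ • ∑ i ∈ Finset.range n, F (O i ω)) atTop
      (𝓝 (∫ o, F o ∂μ)) := by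
  borelize E
  have hFm : AEMeasurable F μ := hF.aestronglyMeasurable.aemeasurable
  have hint : Integrable (fun ω => F (O 0 ω)) P := by
    have := hF
    rw [← (hlaw 0).map_eq] at this
    exact this.comp_aemeasurable (hlaw 0).aemeasurable
  have h := strong_law_ae (fun i ω => F (O i ω)) hint
    (fun i j hij => (iIndepFun_comp_of_hasLaw hindep hlaw hFm).indepFun hij)
    (identDistrib_comp hlaw hFm)
  rwa [show ∫ ω, F (O 0 ω) ∂P = ∫ o, F o ∂μ from
    (hlaw 0).integral_comp hF.aestronglyMeasurable] at h

variable [IsProbabilityMeasure P]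

/-- The weak law of large numbers for a function of the replicates. -/
lemma tendsto_mean_inProb (hindep : iIndepFun O P) (hlaw : ∀ i, HasLaw (O i) μ P)
    {E : Type*} [NormedAddCommGroup E] [NormedSpace ℝ E] [CompleteSpace E]
    [SecondCountableTopology E] {F : S → E} (hF : Integrable F μ) :
    Tendsto (fun x : ℕ × Ω => (x.1 : ℝ)⁻¹ • ∑ i ∈ Finset.range x.1, F (O i x.2)) (inProb P)
      (𝓝 (∫ o, F o ∂μ)) :=
  tendsto_inProb_of_ae
    (X := fun n ω => (n : ℝ)⁻¹ • ∑ i ∈ Finset.range n, F (O i ω))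
    (aestronglyMeasurable_mean hlaw hF.aestronglyMeasurable)
    (tendsto_mean_ae hindep hlaw hF)

/-- With `S_n` the mean of the first `n` terms, `d n / (n + 1) = S_{n+1} - n / (n + 1) * S_n`, and
both terms tend to `m`. -/
lemma tendsto_div_of_mean {d : ℕ → ℝ} {m : ℝ}
    (h : Tendsto (fun n : ℕ => (n : ℝ)⁻¹ * ∑ i ∈ Finset.range n, d i) atTop (𝓝 m)) :
    Tendsto (fun n : ℕ => d n / (n + 1 : ℝ)) atTop (𝓝 0) := by
  have h1 := (tendsto_add_atTop_iff_nat 1).2 h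
  have h2 : Tendsto (fun n : ℕ => (n : ℝ) / (n + 1 : ℝ)) atTop (𝓝 1) :=
    tendsto_natCast_div_add_atTop 1
  have h3 := h1.sub (h2.mul h)
  rw [one_mul, sub_self] at h3
  refine h3.congr' ?_
  filter_upwards [eventually_gt_atTop 0] with n hn
  have : (n : ℝ) ≠ 0 := by positivity
  rw [Finset.sum_range_succ]
  push_cast
  field_simp
  ring

/-- If the means of nonnegative numbers converge, then their squares have means `o(n)`. -/
lemma tendsto_mean_sq_div {d : ℕ → ℝ} {m : ℝ} (hd : ∀ n, 0 ≤ d n)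
    (h : Tendsto (fun n : ℕ => (n : ℝ)⁻¹ * ∑ i ∈ Finset.range n, d i) atTop (𝓝 m)) :
    Tendsto (fun n : ℕ => (n : ℝ)⁻¹ * ((n : ℝ)⁻¹ * ∑ i ∈ Finset.range n, d i ^ 2)) atTop
      (𝓝 0) := by
  have hm : 0 ≤ m := ge_of_tendsto' h fun n => by
    have := Finset.sum_nonneg fun i (_ : i ∈ Finset.range n) => hd i
    positivity
  rw [Metric.tendsto_nhds]
  intro ε hε
  -- The `+ 1` keeps the choice of `η` valid when `m = 0`.
  obtain ⟨η, hη, hηε⟩ : ∃ η > 0, η * (m + 1) < ε :=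
    ⟨ε / (2 * (m + 1)), by positivity, by field_simp; linarith⟩
  obtain ⟨N, hN⟩ := eventually_atTop.1 ((tendsto_div_of_mean h).eventually_lt_const hη)
  set A := ∑ i ∈ Finset.range N, d i ^ 2
  have hA : Tendsto (fun n : ℕ => (n : ℝ)⁻¹ * ((n : ℝ)⁻¹ * A) +
      η * ((n : ℝ)⁻¹ * ∑ i ∈ Finset.range n, d i)) atTop (𝓝 (0 * (0 * A) + η * m)) :=
    ((tendsto_inv_atTop_nhds_zero_nat (𝕜 := ℝ)).mul
      ((tendsto_inv_atTop_nhds_zero_nat (𝕜 := ℝ)).mul_const A)).add (h.const_mul η)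
  have hlt : 0 * (0 * A) + η * m < ε := by nlinarith
  filter_upwards [hA.eventually_lt_const hlt, eventually_gt_atTop 0] with n hn hn0
  have hn0' : (0 : ℝ) < n := by exact_mod_cast hn0
  have hS : 0 ≤ ∑ i ∈ Finset.range n, d i ^ 2 := Finset.sum_nonneg fun i _ => sq_nonneg _
  rw [dist_zero_right, Real.norm_of_nonneg (by positivity)]
  refine lt_of_le_of_lt ?_ hn
  -- The first `N` squares are the fixed amount `A`. Later terms satisfy `d i ≤ η (i + 1) ≤ η n`, so
  -- one factor of the square is traded for `η n`.
  have key : ∑ i ∈ Finset.range n, d i ^ 2 ≤ A + η * n * ∑ i ∈ Finset.range n, d i := by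
    have hterm : ∀ i ∈ Finset.range n,
        d i ^ 2 ≤ (if i < N then d i ^ 2 else 0) + η * n * d i := by
      intro i hi
      have hin : (i : ℝ) + 1 ≤ n := by exact_mod_cast Finset.mem_range.1 hi
      by_cases hiN : i < N
      · simp only [hiN, if_true]
        have := hd i
        have : 0 ≤ η * n * d i := by positivity
        linarith
      · simp only [hiN, if_false, zero_add]
        have h1 := hN i (not_lt.1 hiN)
        rw [div_lt_iff₀ (by positivity)] at h1
        have h2 : d i ≤ η * n := h1.le.trans (mul_le_mul_of_nonneg_left hin hη.le)
        nlinarith [hd i]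
    refine (Finset.sum_le_sum hterm).trans ?_
    rw [Finset.sum_add_distrib, ← Finset.mul_sum]
    gcongr
    rw [← Finset.sum_filter]
    refine Finset.sum_le_sum_of_subset_of_nonneg (fun i hi => ?_) fun _ _ _ => sq_nonneg _
    exact Finset.mem_range.2 (Finset.mem_filter.1 hi).2
  calc (n : ℝ)⁻¹ * ((n : ℝ)⁻¹ * ∑ i ∈ Finset.range n, d i ^ 2)
      ≤ (n : ℝ)⁻¹ * ((n : ℝ)⁻¹ * (A + η * n * ∑ i ∈ Finset.range n, d i)) := by gcongr
    _ = _ := by field_simp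

/-- Root-`n` times the mean of a centred square-integrable function is bounded in probability. -/
lemma tightEvents_mean_real (hindep : iIndepFun O P) (hlaw : ∀ i, HasLaw (O i) μ P)
    {F : S → ℝ} (hF : MemLp F 2 μ) (h0 : ∫ o, F o ∂μ = 0) :
    TightEvents P (fun (M : ℝ) x =>
      |√(x.1 : ℝ) * ((x.1 : ℝ)⁻¹ * ∑ i ∈ Finset.range x.1, F (O i x.2))| ≤ M) := by
  have hFm : AEMeasurable F μ := hF.aestronglyMeasurable.aemeasurable
  have hL : ∀ i, MemLp (fun ω => F (O i ω)) 2 P := fun i => by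
    have := hF
    rw [← (hlaw i).map_eq] at this
    exact this.comp_of_map (hlaw i).aemeasurable
  set Z : ℕ → Ω → ℝ := fun n ω => ∑ i ∈ Finset.range n, F (O i ω)
  have hZL : ∀ n, MemLp (Z n) 2 P := fun n => memLp_finsetSum _ fun i _ => hL i
  set v := Var[fun ω => F (O 0 ω); P]
  have hv : 0 ≤ v := variance_nonneg _ _
  have hvar : ∀ n, Var[Z n; P] = n * v := fun n => by
    have h1 := IndepFun.variance_sum (μ := P) (X := fun i ω => F (O i ω)) (s := Finset.range n)
      (fun i _ => hL i)
      (fun i _ j _ hij => (iIndepFun_comp_of_hasLaw hindep hlaw hFm).indepFun hij)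
    have h2 : Z n = ∑ i ∈ Finset.range n, fun ω => F (O i ω) := by
      ext ω; simp [Z]
    rw [h2, h1, Finset.sum_congr rfl fun i _ => (identDistrib_comp hlaw hFm i).variance_eq]
    simp [v]
  have hmean : ∀ n, P[Z n] = 0 := fun n => by
    simp only [Z]
    rw [integral_finsetSum _ fun i _ => (hL i).integrable one_le_two]
    refine Finset.sum_eq_zero fun i _ => ?_
    rw [← h0]
    exact (hlaw i).integral_comp hF.aestronglyMeasurable
  intro ε hε
  -- Chebyshev at level `√n M` bounds the tail of the sum by `n v / (√n M)² = v / M²`, uniformly in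
  -- `n`.
  obtain ⟨M, hM0, hM⟩ : ∃ M : ℝ, 0 < M ∧ ENNReal.ofReal (v / M ^ 2) ≤ ε := by
    have ht : Tendsto (fun M : ℝ => ENNReal.ofReal (v / M ^ 2)) atTop (𝓝 0) := by
      rw [← ENNReal.ofReal_zero]
      exact ENNReal.tendsto_ofReal ((tendsto_pow_atTop two_ne_zero).const_div_atTop v)
    obtain ⟨M, hM⟩ := ((ENNReal.tendsto_nhds_zero.1 ht ε hε).and (eventually_gt_atTop 0)).exists
    exact ⟨M, hM.2, hM.1⟩
  refine ⟨M, ?_⟩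
  filter_upwards [eventually_gt_atTop 0] with n hn
  have hn' : (0 : ℝ) < n := by exact_mod_cast hn
  refine le_trans ?_ hM
  have hch := meas_ge_le_variance_div_sq (hZL n) (c := √n * M) (by positivity)
  rw [hvar, hmean] at hch
  have he : (n : ℝ) * v / (√n * M) ^ 2 = v / M ^ 2 := by
    rw [mul_pow, Real.sq_sqrt hn'.le]; field_simp
  rw [he] at hch
  refine (measure_mono fun ω hω => ?_).trans hch
  simp only [Set.mem_ofPred_eq, not_le, sub_zero] at hω ⊢
  change M < |√(n : ℝ) * ((n : ℝ)⁻¹ * Z n ω)| at hω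
  rw [← mul_assoc, abs_mul, abs_of_pos (by positivity)] at hω
  have h3 : √(n : ℝ) * (√n * (n : ℝ)⁻¹) = 1 := by
    rw [← mul_assoc, Real.mul_self_sqrt hn'.le, mul_inv_cancel₀ hn'.ne']
  calc √(n : ℝ) * M ≤ √n * (√n * (n : ℝ)⁻¹ * |Z n ω|) := by gcongr
    _ = |Z n ω| := by rw [← mul_assoc, h3, one_mul]

lemma tightEvents_mean {ι : Type*} [Fintype ι] (hindep : iIndepFun O P)
    (hlaw : ∀ i, HasLaw (O i) μ P) {F : S → EuclideanSpace ℝ ι} (hF : MemLp F 2 μ)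
    (h0 : ∫ o, F o ∂μ = 0) :
    TightEvents P (fun (M : ℝ) x =>
      √(x.1 : ℝ) * ‖(x.1 : ℝ)⁻¹ • ∑ i ∈ Finset.range x.1, F (O i x.2)‖ ≤ M) := by
  have : IsFiniteMeasure μ := by rw [← (hlaw 0).map_eq]; infer_instance
  have hc : ∀ a, TightEvents P (fun (M : ℝ) x =>
      |√(x.1 : ℝ) * ((x.1 : ℝ)⁻¹ * ∑ i ∈ Finset.range x.1, F (O i x.2) a)| ≤ M) := fun a => by
    refine tightEvents_mean_real hindep hlaw (F := fun o => F o a) ?_ ?_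
    · exact hF.continuousLinearMap_comp (EuclideanSpace.proj (𝕜 := ℝ) a)
    · have := (EuclideanSpace.proj (𝕜 := ℝ) a).integral_comp_comm (hF.integrable one_le_two)
      simpa [h0] using this
  refine TightEvents.le_sum hc fun x => ?_
  have hn : ∀ w : EuclideanSpace ℝ ι, ‖w‖ ≤ ∑ a, |w a| := fun w => by
    classical
    conv_lhs => rw [← (EuclideanSpace.basisFun ι ℝ).sum_repr w]
    refine (norm_sum_le _ _).trans (Finset.sum_le_sum fun a _ => ?_)
    simp [norm_smul]
  refine (mul_le_mul_of_nonneg_left (hn _) (Real.sqrt_nonneg _)).trans_eq ?_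
  rw [Finset.mul_sum]
  refine Finset.sum_congr rfl fun a _ => ?_
  rw [abs_mul, abs_of_nonneg (Real.sqrt_nonneg _)]
  simp

open scoped RealInnerProductSpace Matrix in
/-- The multivariate central limit theorem for a centred function of the replicates. -/
lemma tendstoInDistribution_sqrt_smul_mean {ι : Type*} [Fintype ι] [DecidableEq ι]
    (hindep : iIndepFun O P) (hlaw : ∀ i, HasLaw (O i) μ P) {F : S → EuclideanSpace ℝ ι}
    (hF : MemLp F 2 μ) (h0 : ∫ o, F o ∂μ = 0) {V : Matrix ι ι ℝ} (hV : V.PosSemidef)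
    (hcov : ∀ t : EuclideanSpace ℝ ι, ∫ o, ⟪F o, t⟫ ^ 2 ∂μ = t ⬝ᵥ V *ᵥ t) :
    TendstoInDistribution (fun (n : ℕ) ω => √(n : ℝ) •
      ((n : ℝ)⁻¹ • ∑ i ∈ Finset.range n, F (O i ω))) atTop
      (id : EuclideanSpace ℝ ι → EuclideanSpace ℝ ι) (fun _ => P) (multivariateGaussian 0 V) := by
  have : IsProbabilityMeasure μ := by
    rw [← (hlaw 0).map_eq]; exact Measure.isProbabilityMeasure_map (hlaw 0).aemeasurable
  have hFm : AEMeasurable F μ := hF.aestronglyMeasurable.aemeasurable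
  have hmeas : ∀ n : ℕ, AEMeasurable (fun ω => √(n : ℝ) •
      ((n : ℝ)⁻¹ • ∑ i ∈ Finset.range n, F (O i ω))) P := fun n =>
    (measurable_const_smul _).comp_aemeasurable
      (aestronglyMeasurable_mean hlaw hF.aestronglyMeasurable n).aemeasurable
  refine ⟨hmeas, aemeasurable_id, ?_⟩
  refine ProbabilityMeasure.tendsto_iff_tendsto_charFun.2 fun t => ?_
  have hFt : MemLp (fun o => ⟪F o, t⟫) 2 μ := by
    simpa only [real_inner_comm] using hF.const_inner t
  have hFtm : AEMeasurable (fun o => ⟪F o, t⟫) μ := hFt.aestronglyMeasurable.aemeasurable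
  have hX : MemLp (fun ω => ⟪F (O 0 ω), t⟫) 2 P := by
    have := hFt
    rw [← (hlaw 0).map_eq] at this
    exact this.comp_of_map (hlaw 0).aemeasurable
  have hmean : ∫ ω, ⟪F (O 0 ω), t⟫ ∂P = 0 := by
    have h1 : ∫ ω, ⟪F (O 0 ω), t⟫ ∂P = ∫ o, ⟪F o, t⟫ ∂μ :=
      (hlaw 0).integral_comp hFt.aestronglyMeasurable
    rw [h1]
    have h2 := integral_inner (𝕜 := ℝ) (hF.integrable one_le_two) t
    simp only [h0, inner_zero_right] at h2
    simpa only [real_inner_comm] using h2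
  have hvar : Var[fun ω => ⟪F (O 0 ω), t⟫; P] = t ⬝ᵥ V *ᵥ t := by
    rw [variance_eq_integral hX.aestronglyMeasurable.aemeasurable, hmean, ← hcov t]
    simp only [sub_zero]
    exact (hlaw 0).integral_comp (f := fun o => ⟪F o, t⟫ ^ 2) (hFt.aestronglyMeasurable.pow 2)
  have hclt := tendstoInDistribution_inv_sqrt_mul_sum_sub (P := P)
    (X := fun i ω => ⟪F (O i ω), t⟫) (HasLaw.id) hX
    (iIndepFun_comp_of_hasLaw hindep hlaw hFtm) (identDistrib_comp hlaw hFtm)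
  -- Cramér–Wold: the characteristic function of the vector at `t` is that of its projection on `t`
  -- at `1`, so the scalar theorem suffices.
  have hchar := ProbabilityMeasure.tendsto_iff_tendsto_charFun.1 hclt.tendsto 1
  simp only [ProbabilityMeasure.coe_mk, Measure.map_id] at hchar ⊢
  rw [charFun_gaussianReal, hvar] at hchar
  rw [charFun_multivariateGaussian hV]
  convert! hchar using 2 with n
  · rw [charFun_apply, charFun_apply, integral_map (hmeas n) (by fun_prop),
      integral_map (hclt.forall_aemeasurable n) (by fun_prop)]
    refine integral_congr_ae (Eventually.of_forall fun ω => ?_)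
    have hs : √(n : ℝ) * (n : ℝ)⁻¹ = (√(n : ℝ))⁻¹ := by
      rcases Nat.eq_zero_or_pos n with rfl | hn
      · simp
      · rw [← div_eq_mul_inv, Real.sqrt_div_self]
    have : ⟪√(n : ℝ) • ((n : ℝ)⁻¹ • ∑ i ∈ Finset.range n, F (O i ω)), t⟫ =
      (√(n : ℝ))⁻¹ * (∑ i ∈ Finset.range n, ⟪F (O i ω), t⟫ - n * ∫ ω, ⟪F (O 0 ω), t⟫ ∂P) := by
      rw [hmean, smul_smul, real_inner_smul_left, sum_inner, hs]
      simp
    simp only [this]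
    simp
  · have hp : 0 ≤ t ⬝ᵥ V *ᵥ t := by rw [← hcov t]; positivity
    simp [Real.coe_toNNReal _ hp]

end IndependentReplicates


/-! ### Taylor bounds on a ball from a bound on the second derivative. -/

section Taylor

variable {E F : Type*} [NormedAddCommGroup E] [NormedSpace ℝ E] [NormedAddCommGroup F]
  [NormedSpace ℝ F]

lemma norm_fderiv_sub_le_of_ball {f : E → F} {x₀ : E} {r B : ℝ}
    (hf : ∀ x ∈ Metric.ball x₀ r, ContDiffAt ℝ 2 f x)
    (hB : ∀ x ∈ Metric.ball x₀ r, ‖iteratedFDeriv ℝ 2 f x‖ ≤ B) {x : E}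
    (hx : x ∈ Metric.ball x₀ r) : ‖fderiv ℝ f x - fderiv ℝ f x₀‖ ≤ B * ‖x - x₀‖ := by
  refine (convex_ball x₀ r).norm_image_sub_le_of_norm_fderiv_le (𝕜 := ℝ) (f := fderiv ℝ f)
    (fun y hy => ?_) (fun y hy => ?_)
    (Metric.mem_ball_self (Metric.pos_of_mem_ball hx)) hx
  · exact ((hf y hy).fderiv_right (m := 1) (by norm_num)).differentiableAt (by norm_num)
  · have h1 : ‖fderiv ℝ (fderiv ℝ f) y‖ = ‖iteratedFDeriv ℝ 2 f y‖ := by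
      rw [← norm_iteratedFDeriv_one (f := fderiv ℝ f), norm_iteratedFDeriv_fderiv]
    exact h1.trans_le (hB y hy)

lemma norm_sub_sub_fderiv_le_of_ball {f : E → F} {x₀ : E} {r B : ℝ}
    (hf : ∀ x ∈ Metric.ball x₀ r, ContDiffAt ℝ 2 f x)
    (hB : ∀ x ∈ Metric.ball x₀ r, ‖iteratedFDeriv ℝ 2 f x‖ ≤ B) {x : E}
    (hx : x ∈ Metric.ball x₀ r) :
    ‖f x - f x₀ - fderiv ℝ f x₀ (x - x₀)‖ ≤ B * ‖x - x₀‖ ^ 2 := by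
  have hB0 : 0 ≤ B := (norm_nonneg _).trans (hB x hx)
  have hsub : Metric.closedBall x₀ ‖x - x₀‖ ⊆ Metric.ball x₀ r :=
    Metric.closedBall_subset_ball (by simpa [dist_eq_norm] using hx)
  -- On the closed ball through `x` the derivative moves by at most `B ‖x - x₀‖`; the sharp factor
  -- `1/2` is not needed.
  have h := (convex_closedBall x₀ ‖x - x₀‖).norm_image_sub_le_of_norm_fderiv_le' (𝕜 := ℝ)
    (f := f) (φ := fderiv ℝ f x₀) (C := B * ‖x - x₀‖)
    (fun y hy => (hf y (hsub hy)).differentiableAt (by norm_num))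
    (fun y hy => (norm_fderiv_sub_le_of_ball hf hB (hsub hy)).trans
      (mul_le_mul_of_nonneg_left (by simpa [dist_eq_norm] using hy) hB0))
    (Metric.mem_closedBall_self (norm_nonneg _)) (y := x) (by simp [dist_eq_norm])
  refine h.trans_eq (by ring)

open scoped RealInnerProductSpace in
/-- Second order expansion along a ray, in terms of the gradient and its derivative. -/
lemma abs_sub_quadratic_le_of_ball {E : Type*} [NormedAddCommGroup E] [InnerProductSpace ℝ E]
    [CompleteSpace E] {f : E → ℝ} {x₀ : E} {r B : ℝ}
    (hd : ∀ x ∈ Metric.ball x₀ r, DifferentiableAt ℝ f x)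
    (hf : ∀ x ∈ Metric.ball x₀ r, ContDiffAt ℝ 2 (gradient f) x)
    (hB : ∀ x ∈ Metric.ball x₀ r, ‖iteratedFDeriv ℝ 2 (gradient f) x‖ ≤ B) {v : E} {s : ℝ}
    (hs : 0 ≤ s) (hsr : s * ‖v‖ < r) :
    |f (x₀ + s • v) - f x₀ -
      (s * ⟪gradient f x₀, v⟫ + s ^ 2 / 2 * ⟪fderiv ℝ (gradient f) x₀ v, v⟫)| ≤
      B * ‖v‖ ^ 3 * s ^ 3 := by
  have hr : 0 < r := (by positivity : 0 ≤ s * ‖v‖).trans_lt hsr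
  have hB0 : 0 ≤ B := (norm_nonneg _).trans (hB x₀ (Metric.mem_ball_self hr))
  have hmem : ∀ t ∈ Set.Icc 0 s, x₀ + t • v ∈ Metric.ball x₀ r := fun t ht => by
    rw [Metric.mem_ball, dist_eq_norm, add_sub_cancel_left, norm_smul, Real.norm_of_nonneg ht.1]
    exact (mul_le_mul_of_nonneg_right ht.2 (norm_nonneg _)).trans_lt hsr
  -- The derivative of `g` is the first-order remainder of the gradient paired with `v`, of size at
  -- most `B ‖v‖³ t²`.
  set g : ℝ → ℝ := fun t => f (x₀ + t • v) -
    (t * ⟪gradient f x₀, v⟫ + t ^ 2 / 2 * ⟪fderiv ℝ (gradient f) x₀ v, v⟫) with hg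
  have hder : ∀ t ∈ Set.Icc 0 s, HasDerivAt g
      ⟪gradient f (x₀ + t • v) - gradient f x₀ - fderiv ℝ (gradient f) x₀ (t • v), v⟫ t := by
    intro t ht
    have h1 : HasDerivAt (fun t : ℝ => x₀ + t • v) v t := by
      simpa using ((hasDerivAt_id t).smul_const v).const_add x₀
    have h2 := (hd _ (hmem t ht)).hasGradientAt.hasFDerivAt.comp_hasDerivAt t h1
    have h3 : HasDerivAt (fun t : ℝ =>
        t * ⟪gradient f x₀, v⟫ + t ^ 2 / 2 * ⟪fderiv ℝ (gradient f) x₀ v, v⟫)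
        (1 * ⟪gradient f x₀, v⟫ + (2 * t ^ 1 * 1) / 2 * ⟪fderiv ℝ (gradient f) x₀ v, v⟫) t :=
      ((hasDerivAt_id t).mul_const _).add ((((hasDerivAt_id t).pow 2).div_const 2).mul_const _)
    refine (h2.sub h3).congr_deriv ?_
    rw [InnerProductSpace.toDual_apply_apply, map_smul, inner_sub_left, inner_sub_left,
      real_inner_smul_left]
    ring
  have h := norm_image_sub_le_of_norm_deriv_le_segment' (f := g) (a := 0) (b := s)
    (C := B * ‖v‖ ^ 3 * s ^ 2) (fun t ht => (hder t ht).hasDerivWithinAt) (fun t ht => ?_)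
    s (Set.right_mem_Icc.2 hs)
  · simp only [hg, Real.norm_eq_abs] at h
    refine le_trans (le_of_eq ?_) (h.trans_eq (by ring))
    congr 1
    simp only [zero_smul, add_zero]
    ring
  · have ht' : t ∈ Set.Icc 0 s := ⟨ht.1, ht.2.le⟩
    have h4 := norm_sub_sub_fderiv_le_of_ball hf hB (hmem t ht')
    rw [add_sub_cancel_left] at h4
    refine (norm_inner_le_norm _ _).trans ((mul_le_mul_of_nonneg_right h4 (norm_nonneg _)).trans ?_)
    rw [norm_smul, Real.norm_of_nonneg ht.1]
    calc B * (t * ‖v‖) ^ 2 * ‖v‖ = B * ‖v‖ ^ 3 * t ^ 2 := by ring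
      _ ≤ B * ‖v‖ ^ 3 * s ^ 2 := by
        gcongr
        · exact ht.1
        · exact ht.2.le

end Taylor

/-! ### First consequences of (C1). -/

namespace Design

variable {d K q : ℕ} {D : Design d K q} {law : D.Param → Measure (Obs d q)} {Θ : Set D.Param}
  {supp : Set (Obs d q)} {θ₀ : D.Param}

namespace ConditionC1

/-- The gradient is the derivative followed by the linear Riesz isometry, so it loses exactly one
order of smoothness. -/
lemma score_contDiffAt (h : D.ConditionC1 law Θ supp θ₀) {o : Obs d q} (ho : o ∈ supp)
    {θ : D.Param} (hθ : θ ∈ Θ) (k : Fin K) : ContDiffAt ℝ 2 (D.score k o) θ := by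
  have h1 : ContDiffAt ℝ 2 (fderiv ℝ (D.logLikelihood k o)) θ :=
    (h.smooth o ho θ hθ k).fderiv_right (by norm_num)
  exact ((InnerProductSpace.toDual ℝ D.Param).symm.contDiff.contDiffAt).comp θ h1

lemma mem (h : D.ConditionC1 law Θ supp θ₀) : θ₀ ∈ Θ := interior_subset h.interior

lemma ae_mem_supp (h : D.ConditionC1 law Θ supp θ₀) : ∀ᵐ o ∂(law θ₀), o ∈ supp :=
  h.support_full θ₀ h.mem

lemma integral_score (h : D.ConditionC1 law Θ supp θ₀) (k : Fin K) :
    ∫ o, D.score k o θ₀ ∂(law θ₀) = 0 := (h.unique_zero k θ₀ h.mem).2 rfl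

/-- The bound on the derivative of the sensitivity, on a ball inside the parameter space. -/
lemma exists_ball (h : D.ConditionC1 law Θ supp θ₀) : ∃ r > 0, ∃ b : Obs d q → ℝ,
    Integrable b (law θ₀) ∧ Metric.ball θ₀ r ⊆ Θ ∧
    ∀ o ∈ supp, ∀ θ ∈ Metric.ball θ₀ r, ∀ k, ‖iteratedFDeriv ℝ 2 (D.score k o) θ‖ ≤ b o := by
  obtain ⟨r, hr, b, hb, hbb⟩ := h.sensitivity_deriv_bounded
  obtain ⟨r', hr', hsub⟩ := Metric.mem_nhds_iff.1 (mem_interior_iff_mem_nhds.1 h.interior)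
  refine ⟨min r r', lt_min hr hr', b, hb,
    (Metric.ball_subset_ball (min_le_right _ _)).trans hsub, fun o ho θ hθ k => ?_⟩
  exact hbb o ho θ (Metric.ball_subset_ball (min_le_left _ _) hθ) k

end ConditionC1

end Design


/-! ### Likelihood ratios and negative definiteness of the expected sensitivity. -/

/-- A lower bound for the remainder of the exponential near zero. -/
lemma sq_div_four_le_exp_sub {x : ℝ} (hx : |x| ≤ 1) : x ^ 2 / 4 ≤ Real.exp x - 1 - x := by
  -- The cubic remainder is at most `2/9 |x|³ ≤ 2/9 x²`, and `1/2 - 2/9 ≥ 1/4`.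
  have h := Real.exp_bound hx (n := 3) (by norm_num)
  simp only [Finset.sum_range_succ, Finset.sum_range_zero, Nat.factorial, Nat.succ_eq_add_one] at h
  norm_num at h
  have h1 := (abs_le.1 h).1
  have h2 : |x| ^ 3 ≤ x ^ 2 := by
    rw [← sq_abs x]
    exact pow_le_pow_of_le_one (abs_nonneg x) hx (by norm_num)
  nlinarith [sq_nonneg x]

namespace Design

variable {d K q : ℕ} {D : Design d K q} {law : D.Param → Measure (Obs d q)} {Θ : Set D.Param}
  {supp : Set (Obs d q)} {θ₀ : D.Param}

/-- Censoring is idempotent and preserves exceedance of the threshold. Hence integrals of likelihood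
contributions over replicates reduce to integrals over the law of the censored pair, the only law
that the model specifies. -/
lemma pairLikelihood_censor (D : Design d K q) (θ : D.Param) (z : Covariates d q) (j l : Fin d)
    (y₁ y₂ : ℝ) :
    D.pairLikelihood θ z j l (D.censor j y₁) (D.censor l y₂) = D.pairLikelihood θ z j l y₁ y₂ := by
  have hc : ∀ j y, D.censor j (D.censor j y) = D.censor j y := fun j y => by simp [censor]
  have ht : ∀ j y, D.threshold j < D.censor j y ↔ D.threshold j < y := fun j y => by simp [censor]
  have hS : ∀ j y, D.InSupport θ z j (D.censor j y) = D.InSupport θ z j y := fun j y => by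
    simp only [InSupport, hc]
  have hF : ∀ j y, D.frechetValue θ z j (D.censor j y) = D.frechetValue θ z j y := fun j y => by
    simp only [frechetValue, hc]
  have hJ : ∀ j y, D.jacobian θ z j (D.censor j y) = D.jacobian θ z j y := fun j y => by
    simp only [jacobian, hc]
  classical
  unfold pairLikelihood
  simp only [hF, hJ, ht]
  refine if_congr ?_ rfl rfl
  rw [hS, hS]

/-- The likelihood contribution of one replicate for the pair `e`. -/
noncomputable def obsLikelihood (D : Design d K q) (θ : D.Param) (e : Fin d × Fin d) (o : Obs d q) : ℝ :=
  D.pairLikelihood θ o.2 e.1 e.2 (o.1 e.1) (o.1 e.2)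

lemma measurable_censorPair (D : Design d K q) (e : Fin d × Fin d) :
    Measurable (fun o : Obs d q => (o.2, D.censor e.1 (o.1 e.1), D.censor e.2 (o.1 e.2))) := by
  unfold censor
  fun_prop

/-- Measurability is assumed for the reference measure; it passes to the law of the censored pair
under `θ₀` by absolute continuity, and then to the replicate by composition. -/
lemma IsModel.aemeasurable_obsLikelihood {covLaw : Measure (Covariates d q)}
    (hm : D.IsModel law Θ covLaw) (hθ₀ : θ₀ ∈ Θ) {θ : D.Param} (hθ : θ ∈ Θ) {k : Fin K}
    {e : Fin d × Fin d} (he : e ∈ D.pairs k) :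
    AEMeasurable (D.obsLikelihood θ e) (law θ₀) := by
  have h1 := hm.measurable_density θ hθ k e he
  have h2 : AEMeasurable (fun w : Covariates d q × ℝ × ℝ =>
      D.pairLikelihood θ w.1 e.1 e.2 w.2.1 w.2.2)
      ((law θ₀).map fun o => (o.2, D.censor e.1 (o.1 e.1), D.censor e.2 (o.1 e.2))) := by
    rw [hm.density θ₀ hθ₀ k e he]
    exact h1.mono_ac (withDensity_absolutelyContinuous _ _)
  have h3 := h2.comp_measurable (D.measurable_censorPair e)
  refine h3.congr (Eventually.of_forall fun o => ?_)
  simp only [Function.comp, pairLikelihood_censor, obsLikelihood]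

/-- The expectation of a likelihood ratio of a censored pair is at most one. -/
lemma IsModel.lintegral_likelihoodRatio_le {covLaw : Measure (Covariates d q)}
    (hm : D.IsModel law Θ covLaw) (hθ₀ : θ₀ ∈ Θ) {θ : D.Param} (hθ : θ ∈ Θ) {k : Fin K}
    {e : Fin d × Fin d} (he : e ∈ D.pairs k) :
    ∫⁻ o, ENNReal.ofReal (D.obsLikelihood θ e o / D.obsLikelihood θ₀ e o) ∂(law θ₀) ≤ 1 := by
  set G : D.Param → Covariates d q × ℝ × ℝ → ℝ :=
    fun θ w => D.pairLikelihood θ w.1 e.1 e.2 w.2.1 w.2.2 with hG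
  have hGm : ∀ θ ∈ Θ, AEMeasurable (G θ) (D.pairVolume covLaw e.1 e.2) :=
    fun θ hθ => hm.measurable_density θ hθ k e he
  have hT := D.measurable_censorPair e
  have hdens := hm.density θ₀ hθ₀ k e he
  have hac := withDensity_absolutelyContinuous (D.pairVolume covLaw e.1 e.2)
    (fun w => ENNReal.ofReal (G θ₀ w))
  have hmeas : AEMeasurable (fun w => ENNReal.ofReal (G θ w / G θ₀ w))
      (D.pairVolume covLaw e.1 e.2) := ((hGm θ hθ).div (hGm θ₀ hθ₀)).ennreal_ofReal
  have hprob := hm.prob θ hθ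
  calc ∫⁻ o, ENNReal.ofReal (D.obsLikelihood θ e o / D.obsLikelihood θ₀ e o) ∂(law θ₀)
      = ∫⁻ w, ENNReal.ofReal (G θ w / G θ₀ w)
          ∂((law θ₀).map fun o => (o.2, D.censor e.1 (o.1 e.1), D.censor e.2 (o.1 e.2))) := by
        rw [lintegral_map' ?_ hT.aemeasurable]
        · simp only [hG, pairLikelihood_censor, obsLikelihood]
        · rw [hdens]; exact hmeas.mono_ac hac
    _ = ∫⁻ w, ENNReal.ofReal (G θ₀ w) * ENNReal.ofReal (G θ w / G θ₀ w)
          ∂(D.pairVolume covLaw e.1 e.2) := by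
        rw [hdens, lintegral_withDensity_eq_lintegral_mul₀ (hGm θ₀ hθ₀).ennreal_ofReal hmeas]
        rfl
    _ ≤ ∫⁻ w, ENNReal.ofReal (G θ w) ∂(D.pairVolume covLaw e.1 e.2) := by
        -- Only an inequality: the density at `θ` may charge points where the density at `θ₀`
        -- vanishes.
        refine lintegral_mono fun w => ?_
        rcases le_or_gt (G θ₀ w) 0 with h0 | h0
        · simp [ENNReal.ofReal_of_nonpos h0]
        · rw [← ENNReal.ofReal_mul h0.le, mul_div_cancel₀ _ h0.ne']
    _ = (law θ).map (fun o => (o.2, D.censor e.1 (o.1 e.1), D.censor e.2 (o.1 e.2)))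
          Set.univ := by
        rw [hm.density θ hθ k e he, withDensity_apply _ MeasurableSet.univ, setLIntegral_univ]
    _ = 1 := by
        rw [Measure.map_apply hT MeasurableSet.univ, Set.preimage_univ, measure_univ]

lemma logLikelihood_eq (D : Design d K q) (k : Fin K) (o : Obs d q) (θ : D.Param) :
    D.logLikelihood k o θ = ∑ e ∈ D.pairs k, Real.log (D.obsLikelihood θ e o) := rfl

lemma IsModel.aemeasurable_logLikelihood {covLaw : Measure (Covariates d q)}
    (hm : D.IsModel law Θ covLaw) (hθ₀ : θ₀ ∈ Θ) {θ : D.Param} (hθ : θ ∈ Θ) (k : Fin K) :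
    AEMeasurable (fun o => D.logLikelihood k o θ) (law θ₀) := by
  simp only [logLikelihood_eq]
  exact Finset.aemeasurable_fun_sum _ fun e he =>
    (hm.aemeasurable_obsLikelihood hθ₀ hθ he).log

/-- The geometric mean of the likelihood ratios of the pairs in a region has expectation at most
one. -/
lemma IsModel.lintegral_exp_logLikelihood_sub_le {covLaw : Measure (Covariates d q)}
    (hm : D.IsModel law Θ covLaw) (h : D.ConditionC1 law Θ supp θ₀) {θ : D.Param} (hθ : θ ∈ Θ)
    {k : Fin K} (hk : (D.pairs k).Nonempty) :
    ∫⁻ o, ENNReal.ofReal (Real.exp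
      ((D.logLikelihood k o θ - D.logLikelihood k o θ₀) / (D.pairs k).card)) ∂(law θ₀) ≤ 1 := by
  set m : ℝ := ((D.pairs k).card : ℝ)
  have hm0 : 0 < m := Nat.cast_pos.2 hk.card_pos
  have hpt : ∀ᵐ o ∂(law θ₀), ENNReal.ofReal (Real.exp
      ((D.logLikelihood k o θ - D.logLikelihood k o θ₀) / m)) ≤
      ∑ e ∈ D.pairs k, ENNReal.ofReal m⁻¹ *
        ENNReal.ofReal (D.obsLikelihood θ e o / D.obsLikelihood θ₀ e o) := by
    filter_upwards [h.ae_mem_supp] with o ho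
    have hpos : ∀ θ ∈ Θ, ∀ e ∈ D.pairs k, 0 < D.obsLikelihood θ e o :=
      fun θ hθ e he => h.support_pos o ho θ hθ k e he
    have hsum : (D.logLikelihood k o θ - D.logLikelihood k o θ₀) / m =
        ∑ e ∈ D.pairs k, m⁻¹ • Real.log (D.obsLikelihood θ e o / D.obsLikelihood θ₀ e o) := by
      rw [logLikelihood_eq, logLikelihood_eq, ← Finset.sum_sub_distrib, ← Finset.smul_sum,
        smul_eq_mul, div_eq_inv_mul]
      congr 1
      exact Finset.sum_congr rfl fun e he =>
        (Real.log_div (hpos θ hθ e he).ne' (hpos θ₀ h.mem e he).ne').symm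
    -- Jensen with equal weights: the geometric mean of the ratios is at most their arithmetic mean.
    -- No independence between pairs is needed.
    have hconv := convexOn_exp.map_sum_le (t := D.pairs k) (w := fun _ => m⁻¹)
      (p := fun e => Real.log (D.obsLikelihood θ e o / D.obsLikelihood θ₀ e o))
      (fun _ _ => by positivity)
      (by rw [Finset.sum_const, nsmul_eq_mul]; exact mul_inv_cancel₀ hm0.ne')
      (fun _ _ => Set.mem_univ _)
    rw [hsum]
    refine (ENNReal.ofReal_le_ofReal hconv).trans ?_
    have hdiv : ∀ e ∈ D.pairs k, 0 < D.obsLikelihood θ e o / D.obsLikelihood θ₀ e o :=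
      fun e he => div_pos (hpos θ hθ e he) (hpos θ₀ h.mem e he)
    rw [ENNReal.ofReal_sum_of_nonneg (fun e he => by positivity)]
    refine Finset.sum_le_sum fun e he => ?_
    rw [smul_eq_mul, ENNReal.ofReal_mul (by positivity), Real.exp_log (hdiv e he)]
  refine (lintegral_mono_ae hpt).trans ?_
  have hmeas : ∀ e ∈ D.pairs k, AEMeasurable (fun o => ENNReal.ofReal m⁻¹ *
      ENNReal.ofReal (D.obsLikelihood θ e o / D.obsLikelihood θ₀ e o)) (law θ₀) := fun e he =>
    (((hm.aemeasurable_obsLikelihood h.mem hθ he).div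
      (hm.aemeasurable_obsLikelihood h.mem h.mem he)).ennreal_ofReal).const_mul _
  rw [lintegral_finsetSum' _ hmeas]
  calc ∑ e ∈ D.pairs k, ∫⁻ o, ENNReal.ofReal m⁻¹ *
        ENNReal.ofReal (D.obsLikelihood θ e o / D.obsLikelihood θ₀ e o) ∂(law θ₀)
      ≤ ∑ e ∈ D.pairs k, ENNReal.ofReal m⁻¹ := by
        refine Finset.sum_le_sum fun e he => ?_
        rw [lintegral_const_mul' _ _ ENNReal.ofReal_ne_top]
        exact mul_le_of_le_one_right' (hm.lintegral_likelihoodRatio_le h.mem hθ he)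
    _ = 1 := by
        rw [Finset.sum_const, nsmul_eq_mul, ← ENNReal.ofReal_natCast,
          ← ENNReal.ofReal_mul (by positivity), mul_inv_cancel₀ hm0.ne', ENNReal.ofReal_one]

open scoped RealInnerProductSpace in
/-- The expected sensitivity of a region is negative definite in every direction in which the
score is not almost surely constant. -/
lemma IsModel.inner_integral_fderiv_score_neg {covLaw : Measure (Covariates d q)}
    (hm : D.IsModel law Θ covLaw) (h : D.ConditionC1 law Θ supp θ₀) {k : Fin K} {v : D.Param}
    (hv : 0 < ∫ o, ⟪D.score k o θ₀, v⟫ ^ 2 ∂(law θ₀)) :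
    ⟪(∫ o, fderiv ℝ (D.score k o) θ₀ ∂(law θ₀)) v, v⟫ < 0 := by
  have hprob := hm.prob θ₀ h.mem
  obtain ⟨r, hr, b, hb, hball, hbound⟩ := h.exists_ball
  -- A region without pairs has zero score, contradicting `hv`.
  have hk : (D.pairs k).Nonempty := by
    by_contra hne
    rw [Finset.not_nonempty_iff_eq_empty] at hne
    have hzero : ∀ o, D.score k o θ₀ = 0 := fun o => by
      have : D.logLikelihood k o = fun _ => 0 := by
        ext θ; rw [logLikelihood_eq, hne, Finset.sum_empty]
      simp [score, this]
    simp [hzero] at hv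
  set m : ℝ := ((D.pairs k).card : ℝ)
  have hm0 : 0 < m := Nat.cast_pos.2 hk.card_pos
  set A := ∫ o, fderiv ℝ (D.score k o) θ₀ ∂(law θ₀)
  set X : Obs d q → ℝ := fun o => ⟪D.score k o θ₀, v⟫
  set Y : Obs d q → ℝ := fun o => ⟪fderiv ℝ (D.score k o) θ₀ v, v⟫
  have hXint : Integrable X (law θ₀) := by
    simpa only [X, real_inner_comm] using (h.integrable_score θ₀ h.mem k).const_inner (𝕜 := ℝ) v
  have hX0 : ∫ o, X o ∂(law θ₀) = 0 := by
    have h1 := integral_inner (𝕜 := ℝ) (h.integrable_score θ₀ h.mem k) v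
    rw [h.integral_score, inner_zero_right] at h1
    simpa only [X, real_inner_comm] using h1
  have hYi := (h.sensitivity_finite k).apply_continuousLinearMap v
  have hYint : Integrable Y (law θ₀) := by
    simpa only [Y, real_inner_comm] using hYi.const_inner (𝕜 := ℝ) v
  have hYA : ∫ o, Y o ∂(law θ₀) = ⟪A v, v⟫ := by
    have h1 := integral_inner (𝕜 := ℝ) hYi v
    rw [← ContinuousLinearMap.integral_apply (h.sensitivity_finite k)] at h1
    simpa only [Y, A, real_inner_comm] using h1
  -- the step sizes
  set s : ℕ → ℝ := fun n => r / (‖v‖ + 1) / (n + 1 : ℝ)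
  have hs0 : ∀ n, 0 < s n := fun n => by positivity
  have hsr : ∀ n, s n * ‖v‖ < r := fun n => by
    have h1 : s n ≤ r / (‖v‖ + 1) := div_le_self (by positivity) (by linarith [n.cast_nonneg (α := ℝ)])
    calc s n * ‖v‖ ≤ r / (‖v‖ + 1) * ‖v‖ := by gcongr
      _ < r := by rw [div_mul_eq_mul_div, div_lt_iff₀ (by positivity)]; nlinarith
  have hslim : Tendsto s atTop (𝓝 0) := by
    have := (tendsto_one_div_add_atTop_nhds_zero_nat (𝕜 := ℝ)).const_mul (r / (‖v‖ + 1))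
    simpa [s, div_eq_mul_inv] using this
  have hsΘ : ∀ n, θ₀ + s n • v ∈ Θ := fun n => hball (by
    rw [Metric.mem_ball, dist_eq_norm, add_sub_cancel_left, norm_smul,
      Real.norm_of_nonneg (hs0 n).le]
    exact hsr n)
  set Δ : ℕ → Obs d q → ℝ := fun n o =>
    D.logLikelihood k o (θ₀ + s n • v) - D.logLikelihood k o θ₀
  have hΔ : ∀ n, ∀ o ∈ supp, |Δ n o - (s n * X o + s n ^ 2 / 2 * Y o)| ≤
      b o * ‖v‖ ^ 3 * s n ^ 3 := fun n o ho =>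
    abs_sub_quadratic_le_of_ball (f := D.logLikelihood k o) (r := r) (B := b o)
      (fun θ hθ => (h.smooth o ho θ (hball hθ) k).differentiableAt (by norm_num))
      (fun θ hθ => h.score_contDiffAt ho (hball hθ) k)
      (fun θ hθ => hbound o ho θ hθ k) (hs0 n).le (hsr n)
  have hΔm : ∀ n, AEMeasurable (Δ n) (law θ₀) := fun n =>
    (hm.aemeasurable_logLikelihood h.mem (hsΘ n) k).sub
      (hm.aemeasurable_logLikelihood h.mem h.mem k)
  have hQint : ∀ n, Integrable (fun o => s n * X o + s n ^ 2 / 2 * Y o) (law θ₀) := fun n =>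
    (hXint.const_mul _).add (hYint.const_mul _)
  have hRint : ∀ n, Integrable (fun o => Δ n o - (s n * X o + s n ^ 2 / 2 * Y o)) (law θ₀) :=
    fun n => by
      refine ((hb.mul_const (‖v‖ ^ 3)).mul_const (s n ^ 3)).mono'
        ((hΔm n).aestronglyMeasurable.sub (hQint n).aestronglyMeasurable) ?_
      filter_upwards [h.ae_mem_supp] with o ho using hΔ n o ho
  have hΔint : ∀ n, Integrable (Δ n) (law θ₀) := fun n => by
    refine ((hRint n).add (hQint n)).congr (Eventually.of_forall fun o => ?_)
    simp
  -- The score is centred at `θ₀`, so the linear term of the expansion drops out.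
  have hΔE : ∀ n, |∫ o, Δ n o ∂(law θ₀) - s n ^ 2 / 2 * ⟪A v, v⟫| ≤
      (∫ o, b o ∂(law θ₀)) * ‖v‖ ^ 3 * s n ^ 3 := fun n => by
    have h1 : ∫ o, Δ n o ∂(law θ₀) - s n ^ 2 / 2 * ⟪A v, v⟫ =
        ∫ o, (Δ n o - (s n * X o + s n ^ 2 / 2 * Y o)) ∂(law θ₀) := by
      rw [integral_sub (hΔint n) (hQint n), integral_add (hXint.const_mul _) (hYint.const_mul _),
        integral_const_mul, integral_const_mul, hX0, hYA]
      ring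
    rw [h1, ← integral_mul_const, ← integral_mul_const, ← Real.norm_eq_abs]
    refine norm_integral_le_of_norm_le ((hb.mul_const _).mul_const _) ?_
    filter_upwards [h.ae_mem_supp] with o ho using hΔ n o ho
  -- the normalised remainder of the exponential
  set f : ℕ → Obs d q → ℝ := fun n o => (s n ^ 2)⁻¹ *
    (Real.exp (Δ n o / m) - 1 - Δ n o / m)
  have hf0 : ∀ n o, 0 ≤ f n o := fun n o => by
    have := Real.add_one_le_exp (Δ n o / m)
    exact mul_nonneg (by positivity) (by linarith)
  have hexpint : ∀ n, Integrable (fun o => Real.exp (Δ n o / m)) (law θ₀) := fun n => by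
    refine ⟨((hΔm n).div_const m).exp.aestronglyMeasurable, ?_⟩
    rw [hasFiniteIntegral_iff_ofReal (Eventually.of_forall fun o => (Real.exp_pos _).le)]
    exact (hm.lintegral_exp_logLikelihood_sub_le h (hsΘ n) hk).trans_lt ENNReal.one_lt_top
  have hexp1 : ∀ n, ∫ o, Real.exp (Δ n o / m) ∂(law θ₀) ≤ 1 := fun n => by
    rw [integral_eq_lintegral_of_nonneg_ae (Eventually.of_forall fun o => (Real.exp_pos _).le)
      (hexpint n).aestronglyMeasurable]
    exact ENNReal.toReal_le_of_le_ofReal zero_le_one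
      (by simpa using hm.lintegral_exp_logLikelihood_sub_le h (hsΘ n) hk)
  have hfint : ∀ n, Integrable (f n) (law θ₀) := fun n =>
    (((hexpint n).sub (integrable_const 1)).sub ((hΔint n).div_const m)).const_mul _
  -- Since `E exp (Δ / m) ≤ 1`, the expectation of `f n` is at most `-E Δ / (m s²)`, which is
  -- computed by `hΔE`.
  have hfE : ∀ n, ∫ o, f n o ∂(law θ₀) ≤
      -⟪A v, v⟫ / (2 * m) + (∫ o, b o ∂(law θ₀)) * ‖v‖ ^ 3 / m * s n := fun n => by
    have h1 : ∫ o, f n o ∂(law θ₀) = (s n ^ 2)⁻¹ * (∫ o, Real.exp (Δ n o / m) ∂(law θ₀) - 1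
        - (∫ o, Δ n o ∂(law θ₀)) / m) := by
      simp only [f]
      have h0 : Integrable (fun o => Real.exp (Δ n o / m) - 1) (law θ₀) :=
        (hexpint n).sub (integrable_const 1)
      rw [integral_const_mul, integral_sub h0 ((hΔint n).div_const m), integral_sub (hexpint n) (integrable_const 1), integral_div]
      simp
    have h2 := (abs_le.1 (hΔE n)).1
    have hsn := hs0 n
    rw [h1]
    calc (s n ^ 2)⁻¹ * (∫ o, Real.exp (Δ n o / m) ∂(law θ₀) - 1 - (∫ o, Δ n o ∂(law θ₀)) / m)
        ≤ (s n ^ 2)⁻¹ * (1 - 1 - (s n ^ 2 / 2 * ⟪A v, v⟫ -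
            (∫ o, b o ∂(law θ₀)) * ‖v‖ ^ 3 * s n ^ 3) / m) := by
          gcongr
          · exact hexp1 n
          · linarith
      _ = _ := by field_simp; ring
  have hfatou := lintegral_liminf_le' (u := atTop) (μ := law θ₀) (f := fun n o => ENNReal.ofReal (f n o))
    (fun n => (hfint n).aestronglyMeasurable.aemeasurable.ennreal_ofReal)
  -- Pointwise `Δ / s → X`, and the quadratic lower bound for `exp x - 1 - x` applies once `|Δ / m|
  -- ≤ 1`. Nonnegativity of `f` lets Fatou replace a dominating function.
  have hlower : ∀ᵐ o ∂(law θ₀), ENNReal.ofReal (X o ^ 2 / (4 * m ^ 2)) ≤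
      liminf (fun n => ENNReal.ofReal (f n o)) atTop := by
    filter_upwards [h.ae_mem_supp] with o ho
    have hquot : Tendsto (fun n => (s n)⁻¹ * Δ n o) atTop (𝓝 (X o)) := by
      have h0 : Tendsto (fun n => (s n)⁻¹ * (Δ n o - (s n * X o + s n ^ 2 / 2 * Y o))) atTop
          (𝓝 0) := by
        refine squeeze_zero_norm (a := fun n => b o * ‖v‖ ^ 3 * s n ^ 2) (fun n => ?_) ?_
        · have hsn := hs0 n
          rw [norm_mul, norm_inv, Real.norm_of_nonneg hsn.le, Real.norm_eq_abs]
          calc (s n)⁻¹ * |Δ n o - (s n * X o + s n ^ 2 / 2 * Y o)|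
              ≤ (s n)⁻¹ * (b o * ‖v‖ ^ 3 * s n ^ 3) := by gcongr; exact hΔ n o ho
            _ = _ := by field_simp
        · simpa using (hslim.pow 2).const_mul (b o * ‖v‖ ^ 3)
      have h1 := h0.add ((hslim.mul_const (Y o / 2)).const_add (X o))
      rw [zero_mul, add_zero, zero_add] at h1
      refine h1.congr fun n => ?_
      have hsn := (hs0 n).ne'
      field_simp
      ring
    have hlim : Tendsto (fun n => ENNReal.ofReal (((s n)⁻¹ * Δ n o) ^ 2 / (4 * m ^ 2))) atTop
        (𝓝 (ENNReal.ofReal (X o ^ 2 / (4 * m ^ 2)))) :=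
      ENNReal.tendsto_ofReal ((hquot.pow 2).div_const _)
    rw [← hlim.liminf_eq]
    refine liminf_le_liminf ?_
    have hsmall : Tendsto (fun n => |Δ n o / m|) atTop (𝓝 0) := by
      have h2 := ((hslim.mul hquot).div_const m).abs
      rw [zero_mul, zero_div, abs_zero] at h2
      refine h2.congr fun n => ?_
      rw [mul_inv_cancel_left₀ (hs0 n).ne']
    filter_upwards [hsmall.eventually_le_const one_pos] with n hn
    refine ENNReal.ofReal_le_ofReal ?_
    have hsn := hs0 n
    calc ((s n)⁻¹ * Δ n o) ^ 2 / (4 * m ^ 2) = (s n ^ 2)⁻¹ * ((Δ n o / m) ^ 2 / 4) := by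
          field_simp
      _ ≤ f n o := by
          simp only [f]
          gcongr
          exact sq_div_four_le_exp_sub hn
  have hlimR : Tendsto (fun n => ENNReal.ofReal
      (-⟪A v, v⟫ / (2 * m) + (∫ o, b o ∂(law θ₀)) * ‖v‖ ^ 3 / m * s n)) atTop
      (𝓝 (ENNReal.ofReal (-⟪A v, v⟫ / (2 * m)))) := by
    refine ENNReal.tendsto_ofReal ?_
    simpa using (hslim.const_mul ((∫ o, b o ∂(law θ₀)) * ‖v‖ ^ 3 / m)).const_add
      (-⟪A v, v⟫ / (2 * m))
  have hfinal : ∫⁻ o, ENNReal.ofReal (X o ^ 2 / (4 * m ^ 2)) ∂(law θ₀) ≤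
      ENNReal.ofReal (-⟪A v, v⟫ / (2 * m)) := by
    refine (lintegral_mono_ae hlower).trans (hfatou.trans ?_)
    rw [← hlimR.liminf_eq]
    refine liminf_le_liminf (Eventually.of_forall fun n => ?_)
    change ∫⁻ o, ENNReal.ofReal (f n o) ∂(law θ₀) ≤ _
    rw [← ofReal_integral_eq_lintegral_ofReal (hfint n) (Eventually.of_forall (hf0 n))]
    exact ENNReal.ofReal_le_ofReal (hfE n)
  by_contra hcon
  have hzero : -⟪A v, v⟫ / (2 * m) ≤ 0 :=
    div_nonpos_of_nonpos_of_nonneg (by linarith) (by positivity)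
  rw [ENNReal.ofReal_of_nonpos hzero, nonpos_iff_eq_zero] at hfinal
  have hXm : AEMeasurable (fun o => ENNReal.ofReal (X o ^ 2 / (4 * m ^ 2))) (law θ₀) :=
    ((hXint.aestronglyMeasurable.aemeasurable.pow_const 2).div_const _).ennreal_ofReal
  rw [lintegral_eq_zero_iff' hXm] at hfinal
  have hX2 : ∫ o, X o ^ 2 ∂(law θ₀) = 0 := by
    refine integral_eq_zero_of_ae ?_
    filter_upwards [hfinal] with o ho
    have h1 : X o ^ 2 / (4 * m ^ 2) ≤ 0 := ENNReal.ofReal_eq_zero.1 ho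
    have h2 : 0 < 4 * m ^ 2 := by positivity
    have h3 : X o ^ 2 ≤ 0 := by
      rw [div_le_iff₀ h2, zero_mul] at h1; exact h1
    exact le_antisymm h3 (sq_nonneg _)
  exact hv.ne' hX2

end Design


/-! ### The expected score near the true value, and asymptotics of the regional estimators. -/

namespace Design

variable {d K q : ℕ} {D : Design d K q} {law : D.Param → Measure (Obs d q)} {Θ : Set D.Param}
  {supp : Set (Obs d q)} {θ₀ : D.Param} {covLaw : Measure (Covariates d q)}

/-- The expectation of the score at `θ` under the true value. -/
noncomputable def expectedScore (D : Design d K q) (law : D.Param → Measure (Obs d q))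
    (θ₀ : D.Param) (k : Fin K) (θ : D.Param) : D.Param := ∫ o, D.score k o θ ∂(law θ₀)

/-- The expected derivative of the score at the true value, as a linear map. -/
noncomputable def expectedDeriv (D : Design d K q) (law : D.Param → Measure (Obs d q))
    (θ₀ : D.Param) (k : Fin K) : D.Param →L[ℝ] D.Param :=
  ∫ o, fderiv ℝ (D.score k o) θ₀ ∂(law θ₀)

lemma ConditionC1.memLp_score (h : D.ConditionC1 law Θ supp θ₀) (k : Fin K) :
    MemLp (fun o => D.score k o θ₀) 2 (law θ₀) := h.variability_finite θ₀ h.mem k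

lemma ConditionC1.memLp_score_apply (h : D.ConditionC1 law Θ supp θ₀) (a : Fin K × D.Idx) :
    MemLp (fun o => D.score a.1 o θ₀ a.2) 2 (law θ₀) :=
  (h.memLp_score a.1).continuousLinearMap_comp (EuclideanSpace.proj (𝕜 := ℝ) a.2)

lemma ConditionC1.integral_score_apply (hm : D.IsModel law Θ covLaw)
    (h : D.ConditionC1 law Θ supp θ₀) (a : Fin K × D.Idx) :
    ∫ o, D.score a.1 o θ₀ a.2 ∂(law θ₀) = 0 := by
  have hprob := hm.prob θ₀ h.mem
  have := (EuclideanSpace.proj (𝕜 := ℝ) a.2).integral_comp_comm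
    ((h.memLp_score a.1).integrable one_le_two)
  simpa [h.integral_score] using this

lemma ConditionC1.variability_apply (hm : D.IsModel law Θ covLaw)
    (h : D.ConditionC1 law Θ supp θ₀) (a b : Fin K × D.Idx) :
    D.variability law θ₀ a b = ∫ o, D.score a.1 o θ₀ a.2 * D.score b.1 o θ₀ b.2 ∂(law θ₀) := by
  have hprob := hm.prob θ₀ h.mem
  rw [variability, Matrix.of_apply,
    covariance_eq_sub (h.memLp_score_apply a) (h.memLp_score_apply b),
    h.integral_score_apply hm a, zero_mul, sub_zero]
  rfl

open scoped Matrix in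
-- As the stacked score is centred at `θ₀`, its covariance is its second-moment matrix. This serves
-- both the positivity of `E⟪ψ, v⟫²` and the variance of the influence function.
lemma ConditionC1.integral_sum_sq (hm : D.IsModel law Θ covLaw)
    (h : D.ConditionC1 law Θ supp θ₀) (x : Fin K × D.Idx → ℝ) :
    ∫ o, (∑ a, x a * D.score a.1 o θ₀ a.2) ^ 2 ∂(law θ₀) =
      x ⬝ᵥ D.variability law θ₀ *ᵥ x := by
  have hint : ∀ a b : Fin K × D.Idx, Integrable (fun o =>
      x a * D.score a.1 o θ₀ a.2 * (x b * D.score b.1 o θ₀ b.2)) (law θ₀) := fun a b =>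
    ((h.memLp_score_apply a).const_mul (x a)).integrable_mul
      ((h.memLp_score_apply b).const_mul (x b))
  simp only [sq, Finset.sum_mul_sum]
  rw [integral_finsetSum _ fun a _ => integrable_finsetSum _ fun b _ => hint a b]
  simp only [dotProduct, Matrix.mulVec, Finset.mul_sum]
  refine Finset.sum_congr rfl fun a _ => ?_
  rw [integral_finsetSum _ fun b _ => hint a b]
  refine Finset.sum_congr rfl fun b _ => ?_
  rw [h.variability_apply hm, ← integral_mul_const, ← integral_const_mul]
  refine integral_congr_ae (Eventually.of_forall fun o => ?_)
  ring

open scoped RealInnerProductSpace in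
lemma IsModel.inner_expectedDeriv_neg (hm : D.IsModel law Θ covLaw)
    (h : D.ConditionC1 law Θ supp θ₀) (k : Fin K) {v : D.Param} (hv : v ≠ 0) :
    ⟪D.expectedDeriv law θ₀ k v, v⟫ < 0 := by
  refine hm.inner_integral_fderiv_score_neg h ?_
  classical
  -- Padding `v` with zeros in the other regions brings in the positive definiteness of the full
  -- `c(θ₀)`.
  set x : Fin K × D.Idx → ℝ := fun a => if a.1 = k then v a.2 else 0
  have hx : x ≠ 0 := fun h0 => hv (by
    ext i
    simpa [x] using congrFun h0 (k, i))
  have hpos := (h.variability_posDef θ₀ h.mem).dotProduct_mulVec_pos hx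
  simp only [star_trivial] at hpos
  rw [← h.integral_sum_sq hm] at hpos
  have hinner : ∀ o, ⟪D.score k o θ₀, v⟫ = ∑ a, x a * D.score a.1 o θ₀ a.2 := fun o => by
    simp [x, PiLp.inner_apply, Fintype.sum_prod_type, Finset.sum_ite_irrel, ite_mul]
  simpa only [hinner] using hpos

/-- A negative quadratic form makes the map injective, and in finite dimension an injective linear
map is bounded below. -/
lemma IsModel.exists_le_norm_expectedDeriv (hm : D.IsModel law Θ covLaw)
    (h : D.ConditionC1 law Θ supp θ₀) (k : Fin K) :
    ∃ c > 0, ∀ v, c * ‖v‖ ≤ ‖D.expectedDeriv law θ₀ k v‖ := by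
  have hker : LinearMap.ker (D.expectedDeriv law θ₀ k).toLinearMap = ⊥ := by
    rw [LinearMap.ker_eq_bot']
    intro v hv
    by_contra hne
    have := hm.inner_expectedDeriv_neg h k hne
    rw [show D.expectedDeriv law θ₀ k v = 0 from hv, inner_zero_left] at this
    exact lt_irrefl _ this
  obtain ⟨c, hc, hlip⟩ := LinearMap.exists_antilipschitzWith _ hker
  refine ⟨(c : ℝ)⁻¹, by positivity, fun v => ?_⟩
  have h1 := hlip.le_mul_dist v 0
  simp only [dist_zero_right, map_zero] at h1
  have hc' : (0 : ℝ) < c := by exact_mod_cast hc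
  rw [inv_mul_le_iff₀ hc']
  exact h1

/-- The Taylor bound for each replicate has the integrable constant `b o`, so integrating it gives
an expansion of the expected score with `B = E b`. -/
lemma ConditionC1.exists_norm_expectedScore_sub_le (h : D.ConditionC1 law Θ supp θ₀)
    (k : Fin K) : ∃ r > 0, ∃ B : ℝ, ∀ θ ∈ Metric.ball θ₀ r,
      ‖D.expectedScore law θ₀ k θ - D.expectedDeriv law θ₀ k (θ - θ₀)‖ ≤ B * ‖θ - θ₀‖ ^ 2 := by
  obtain ⟨r, hr, b, hb, hball, hbound⟩ := h.exists_ball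
  refine ⟨r, hr, ∫ o, b o ∂(law θ₀), fun θ hθ => ?_⟩
  have hs := h.integrable_score θ (hball hθ) k
  have hs0 := h.integrable_score θ₀ h.mem k
  have hd := (h.sensitivity_finite k).apply_continuousLinearMap (θ - θ₀)
  have he : D.expectedScore law θ₀ k θ - D.expectedDeriv law θ₀ k (θ - θ₀) =
      ∫ o, (D.score k o θ - D.score k o θ₀ - fderiv ℝ (D.score k o) θ₀ (θ - θ₀)) ∂(law θ₀) := by
    have hss : Integrable (fun o => D.score k o θ - D.score k o θ₀) (law θ₀) := hs.sub hs0
    rw [integral_sub hss hd, integral_sub hs hs0, h.integral_score, sub_zero,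
      ← ContinuousLinearMap.integral_apply (h.sensitivity_finite k)]
    rfl
  rw [he, ← integral_mul_const]
  refine norm_integral_le_of_norm_le (hb.mul_const _) ?_
  filter_upwards [h.ae_mem_supp] with o ho
  exact norm_sub_sub_fderiv_le_of_ball (fun y hy => h.score_contDiffAt ho (hball hy) k)
    (fun y hy => hbound o ho y hy k) hθ

section Sample

variable {Ω : Type*} [MeasurableSpace Ω] {P : Measure Ω}
  {O : ℕ → Ω → Obs d q}

/-- Condition (C2) in terms of tight events. -/
lemma ConditionC2.tightEvents (h2 : D.ConditionC2 law Θ θ₀ P O) (hΘ : IsCompact Θ) (k : Fin K) :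
    TightEvents P (fun (M : ℝ) x => ∀ θ ∈ Θ,
      ‖D.meanScore k x.1 (fun i => O i x.2) θ - D.meanScore k x.1 (fun i => O i x.2) θ₀
        - D.expectedScore law θ₀ k θ‖ ≤
      M * ((√(x.1 : ℝ))⁻¹ * ((√(x.1 : ℝ))⁻¹ + ‖θ - θ₀‖))) := by
  obtain ⟨R, hR⟩ := hΘ.isBounded.subset_closedBall θ₀
  intro ε hε
  -- With `δ_n = n` the constraint `‖θ - θ₀‖ ≤ δ_n` eventually holds on all of the bounded set `Θ`.
  obtain ⟨M, hM0, hM⟩ := h2 (fun n => (n : ℝ)) tendsto_natCast_atTop_atTop k ε hε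
  refine ⟨M, ?_⟩
  filter_upwards [hM, eventually_gt_atTop 0,
    (tendsto_natCast_atTop_atTop (R := ℝ)).eventually_ge_atTop R] with n hn hn0 hnR
  refine (measure_mono fun ω hω => ?_).trans hn
  simp only [Set.mem_ofPred_eq, not_forall, not_le] at hω ⊢
  obtain ⟨θ, hθ, hlt⟩ := hω
  have hθn : θ ∈ {θ | θ ∈ Θ ∧ ‖θ - θ₀‖ ≤ (n : ℝ)} := by
    refine ⟨hθ, ?_⟩
    have := hR hθ
    rw [Metric.mem_closedBall, dist_eq_norm] at this
    exact this.trans hnR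
  refine lt_of_lt_of_le ?_ (le_iSup₂ (f := fun θ (_ : θ ∈ {θ | θ ∈ Θ ∧ ‖θ - θ₀‖ ≤ (n : ℝ)}) =>
    ENNReal.ofReal (√(n : ℝ) / (1 + √(n : ℝ) * ‖θ - θ₀‖) *
          ‖D.meanScore k n (fun i => O i ω) θ - D.meanScore k n (fun i => O i ω) θ₀
            - ∫ o, D.score k o θ ∂(law θ₀)‖)) θ hθn)
  have hn' : (0 : ℝ) < √(n : ℝ) := Real.sqrt_pos.2 (by exact_mod_cast hn0)
  rw [ENNReal.ofReal_lt_ofReal_iff']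
  have hden : 0 < 1 + √(n : ℝ) * ‖θ - θ₀‖ := by positivity
  have key : M * (√(n : ℝ))⁻¹ < √(n : ℝ) / (1 + √(n : ℝ) * ‖θ - θ₀‖) *
      ‖D.meanScore k n (fun i => O i ω) θ - D.meanScore k n (fun i => O i ω) θ₀
            - ∫ o, D.score k o θ ∂(law θ₀)‖ := by
    rw [div_mul_eq_mul_div, lt_div_iff₀ hden]
    have := mul_lt_mul_of_pos_left hlt hn'
    refine lt_of_eq_of_lt ?_ this
    field_simp
  exact ⟨key, lt_of_le_of_lt (by positivity) key⟩

lemma ConditionC2.eventually_uniform (h2 : D.ConditionC2 law Θ θ₀ P O) (hΘ : IsCompact Θ)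
    (k : Fin K) {η : ℝ} (hη : 0 < η) :
    ∀ᶠ x in inProb P, ∀ θ ∈ Θ,
      ‖D.meanScore k x.1 (fun i => O i x.2) θ - D.meanScore k x.1 (fun i => O i x.2) θ₀
        - D.expectedScore law θ₀ k θ‖ < η := by
  obtain ⟨R, hR⟩ := hΘ.isBounded.subset_closedBall θ₀
  refine (h2.tightEvents hΘ k).eventually fun M => ?_
  have hsq : Tendsto (fun x : ℕ × Ω => (√(x.1 : ℝ))⁻¹) (inProb P) (𝓝 0) :=
    (tendsto_inv_atTop_zero.comp (Real.tendsto_sqrt_atTop.comp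
      tendsto_natCast_atTop_atTop)).comp tendsto_fst_inProb
  have hlim : Tendsto (fun x : ℕ × Ω => |M| * ((√(x.1 : ℝ))⁻¹ * ((√(x.1 : ℝ))⁻¹ + R))) (inProb P)
      (𝓝 0) := by
    simpa using (hsq.mul (hsq.add_const R)).const_mul |M|
  filter_upwards [hlim.eventually_lt_const hη] with x hx hG θ hθ
  refine ((hG θ hθ).trans ?_).trans_lt hx
  have h1 := hR hθ
  rw [Metric.mem_closedBall, dist_eq_norm] at h1
  gcongr
  exact le_abs_self M

lemma ConditionC1.eventually_mem_supp (h : D.ConditionC1 law Θ supp θ₀)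
    (hlaw : ∀ i, HasLaw (O i) (law θ₀) P) :
    ∀ᶠ x in inProb P, ∀ i, O i x.2 ∈ supp :=
  eventually_inProb_of_ae (p := fun ω => ∀ i, O i ω ∈ supp)
    (ae_comp_of_hasLaw hlaw h.ae_mem_supp)

variable [IsProbabilityMeasure P]

/-- Away from `θ₀` no domination of the scores is available. Instead, (C2) provides for every `η` a
single sample whose centred mean score, a continuous function of `θ`, is uniformly `η`-close to the
expected score. -/
lemma ConditionC1.continuousOn_expectedScore (h : D.ConditionC1 law Θ supp θ₀)
    (h2 : D.ConditionC2 law Θ θ₀ P O) (hΘ : IsCompact Θ)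
    (hlaw : ∀ i, HasLaw (O i) (law θ₀) P) (k : Fin K) :
    ContinuousOn (D.expectedScore law θ₀ k) Θ := by
  refine continuousOn_of_uniform_approx_of_continuousOn fun u hu => ?_
  obtain ⟨η, hη, hηu⟩ := Metric.mem_uniformity_dist.1 hu
  obtain ⟨x, hx, hxs⟩ := ((h2.eventually_uniform hΘ k hη).and (h.eventually_mem_supp hlaw)).exists
  refine ⟨fun θ => D.meanScore k x.1 (fun i => O i x.2) θ
    - D.meanScore k x.1 (fun i => O i x.2) θ₀, ?_, fun θ hθ => hηu ?_⟩
  · unfold meanScore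
    refine ContinuousOn.sub (ContinuousOn.fun_const_smul (continuousOn_finsetSum _ fun i _ => ?_) _)
      continuousOn_const
    exact fun θ hθ => (h.score_contDiffAt (hxs i) hθ k).continuousAt.continuousWithinAt
  · rw [dist_comm, dist_eq_norm]
    exact hx θ hθ

lemma ConditionC1.tightEvents_meanScore
    (h : D.ConditionC1 law Θ supp θ₀) (hindep : iIndepFun O P)
    (hlaw : ∀ i, HasLaw (O i) (law θ₀) P) (k : Fin K) :
    TightEvents P (fun (M : ℝ) x =>
      √(x.1 : ℝ) * ‖D.meanScore k x.1 (fun i => O i x.2) θ₀‖ ≤ M) := by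
  unfold meanScore
  exact tightEvents_mean (ι := D.Idx) (F := fun o => D.score k o θ₀) hindep hlaw (h.memLp_score k) (h.integral_score k)

lemma ConditionC1.tendsto_meanScore (h : D.ConditionC1 law Θ supp θ₀) (hindep : iIndepFun O P)
    (hlaw : ∀ i, HasLaw (O i) (law θ₀) P) (k : Fin K) :
    Tendsto (fun x : ℕ × Ω => D.meanScore k x.1 (fun i => O i x.2) θ₀) (inProb P) (𝓝 0) := by
  have := tendsto_mean_inProb hindep hlaw (h.integrable_score θ₀ h.mem k)
  rwa [h.integral_score] at this

/-- Consistency of a root of the score equation. -/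
lemma ConditionC1.tendsto_estimator (h : D.ConditionC1 law Θ supp θ₀)
    (h2 : D.ConditionC2 law Θ θ₀ P O) (hΘ : IsCompact Θ) (hindep : iIndepFun O P)
    (hlaw : ∀ i, HasLaw (O i) (law θ₀) P) {k : Fin K} {T : ℕ × Ω → D.Param}
    (hT : ∀ x, T x ∈ Θ)
    (hroot : ∀ᶠ x in inProb P, D.meanScore k x.1 (fun i => O i x.2) (T x) = 0) :
    Tendsto T (inProb P) (𝓝 θ₀) := by
  rw [Metric.tendsto_nhds]
  intro ε hε
  have hcomp : IsCompact (Θ \ Metric.ball θ₀ ε) := hΘ.diff Metric.isOpen_ball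
  have hcont := (h.continuousOn_expectedScore h2 hΘ hlaw k).norm.mono
    (Set.sdiff_subset (t := Metric.ball θ₀ ε))
  -- Continuity, compactness and uniqueness of the zero make the root well separated.
  obtain ⟨c, hc, hlow⟩ : ∃ c > 0, ∀ θ ∈ Θ \ Metric.ball θ₀ ε, c ≤ ‖D.expectedScore law θ₀ k θ‖ := by
    rcases (Θ \ Metric.ball θ₀ ε).eq_empty_or_nonempty with he | hne
    · exact ⟨1, one_pos, by simp [he]⟩
    · obtain ⟨θ₁, hθ₁, hmin⟩ := hcomp.exists_isMinOn hne hcont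
      refine ⟨_, norm_pos_iff.2 fun h0 => hθ₁.2 ?_, fun θ hθ => hmin hθ⟩
      rw [(h.unique_zero k θ₁ hθ₁.1).1 h0]
      exact Metric.mem_ball_self hε
  have hΨ := (h.tendsto_meanScore hindep hlaw k).norm
  rw [norm_zero] at hΨ
  filter_upwards [h2.eventually_uniform hΘ k (half_pos hc), hΨ.eventually_lt_const (half_pos hc),
    hroot] with x hx1 hx2 hx3
  by_contra hnot
  have h3 := hlow (T x) ⟨hT x, hnot⟩
  have h4 := hx1 (T x) (hT x)
  -- At a root the deviation in (C2) is minus the sum of the mean score at `θ₀` and the expected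
  -- score at the root.
  rw [hx3, zero_sub, ← neg_add', norm_neg] at h4
  have h5 := norm_sub_le (D.meanScore k x.1 (fun i => O i x.2) θ₀ + D.expectedScore law θ₀ k (T x))
    (D.meanScore k x.1 (fun i => O i x.2) θ₀)
  rw [add_sub_cancel_left] at h5
  linarith

/-- Root-`n` consistency of a root of the score equation. -/
lemma ConditionC1.tightEvents_estimator (hm : D.IsModel law Θ covLaw)
    (h : D.ConditionC1 law Θ supp θ₀)
    (h2 : D.ConditionC2 law Θ θ₀ P O) (hΘ : IsCompact Θ) (hindep : iIndepFun O P)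
    (hlaw : ∀ i, HasLaw (O i) (law θ₀) P) {k : Fin K} {T : ℕ × Ω → D.Param}
    (hT : ∀ x, T x ∈ Θ)
    (hroot : ∀ᶠ x in inProb P, D.meanScore k x.1 (fun i => O i x.2) (T x) = 0) :
    TightEvents P (fun (M : ℝ) x => √(x.1 : ℝ) * ‖T x - θ₀‖ ≤ M) := by
  obtain ⟨c, hc, hlow⟩ := hm.exists_le_norm_expectedDeriv h k
  obtain ⟨r, hr, B, hexp⟩ := h.exists_norm_expectedScore_sub_le k
  have hcons := h.tendsto_estimator h2 hΘ hindep hlaw hT hroot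
  have hδ : Tendsto (fun x => ‖T x - θ₀‖) (inProb P) (𝓝 0) :=
    tendsto_iff_norm_sub_tendsto_zero.1 hcons
  have hBδ : Tendsto (fun x => B * ‖T x - θ₀‖) (inProb P) (𝓝 0) := by
    simpa using hδ.const_mul B
  refine ((h2.tightEvents hΘ k).and (h.tightEvents_meanScore hindep hlaw k)).mono
    -- The factor `2 / c` inverts `c / 2 * δ ≤ ‖E‖`, and `|M.1| * 2` bounds `M.1 * (s⁻¹ + δ)` once
    -- `s⁻¹` and `δ` are at most one.
    fun M => ⟨(2 / c) * (|M.1| * 2 + M.2), ?_⟩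
  filter_upwards [hroot, hδ.eventually_lt_const hr, hδ.eventually_lt_const one_pos,
    hBδ.eventually_lt_const (half_pos hc),
    tendsto_fst_inProb.eventually_ge_atTop 1] with x hx1 hx2 hx3 hx4 hx5 hG
  obtain ⟨hG1, hG2⟩ := hG
  set s := √(x.1 : ℝ)
  have hs : 1 ≤ s := Real.one_le_sqrt.2 (by exact_mod_cast hx5)
  set δ := ‖T x - θ₀‖
  have hδ0 : 0 ≤ δ := norm_nonneg _
  set Ψ := D.meanScore k x.1 (fun i => O i x.2) θ₀
  set E := D.expectedScore law θ₀ k (T x)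
  have h4 := hG1 (T x) (hT x)
  rw [hx1, zero_sub, ← neg_add', norm_neg] at h4
  have h5 : ‖E‖ ≤ ‖Ψ + E‖ + ‖Ψ‖ := by
    have := norm_sub_le (Ψ + E) Ψ
    rwa [add_sub_cancel_left] at this
  have h6 := hexp (T x) (by rwa [Metric.mem_ball, dist_eq_norm])
  have h7 := hlow (T x - θ₀)
  have h8 : ‖D.expectedDeriv law θ₀ k (T x - θ₀)‖ ≤ ‖E‖ + B * δ ^ 2 := by
    have := norm_sub_le E (E - D.expectedDeriv law θ₀ k (T x - θ₀))
    rw [sub_sub_cancel] at this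
    linarith
  -- By consistency `B δ < c / 2`, so the quadratic remainder is absorbed in half of the linear
  -- term.
  have h9 : c / 2 * δ ≤ ‖E‖ := by nlinarith
  have h10 : s * ‖Ψ + E‖ ≤ |M.1| * 2 := by
    have hsi : s⁻¹ ≤ 1 := inv_le_one_of_one_le₀ hs
    have hs0 : 0 < s := by linarith
    calc s * ‖Ψ + E‖ ≤ s * (M.1 * (s⁻¹ * (s⁻¹ + δ))) := by gcongr
      _ = M.1 * (s⁻¹ + δ) := by field_simp
      _ ≤ |M.1| * (1 + 1) := by
        gcongr
        exact le_abs_self _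
      _ = |M.1| * 2 := by norm_num
  have h11 : s * (c / 2 * δ) ≤ |M.1| * 2 + M.2 := by
    have h12 : s * (c / 2 * δ) ≤ s * (‖Ψ + E‖ + ‖Ψ‖) := by gcongr; linarith
    linarith
  calc s * δ = (2 / c) * (s * (c / 2 * δ)) := by field_simp
    _ ≤ (2 / c) * (|M.1| * 2 + M.2) := by gcongr

/-- Linearization of the score equation at a root. -/
lemma ConditionC1.tendsto_linearization (hm : D.IsModel law Θ covLaw)
    (h : D.ConditionC1 law Θ supp θ₀)
    (h2 : D.ConditionC2 law Θ θ₀ P O) (hΘ : IsCompact Θ) (hindep : iIndepFun O P)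
    (hlaw : ∀ i, HasLaw (O i) (law θ₀) P) {k : Fin K} {T : ℕ × Ω → D.Param}
    (hT : ∀ x, T x ∈ Θ)
    (hroot : ∀ᶠ x in inProb P, D.meanScore k x.1 (fun i => O i x.2) (T x) = 0) :
    Tendsto (fun x : ℕ × Ω => √(x.1 : ℝ) • (D.expectedDeriv law θ₀ k (T x - θ₀) +
      D.meanScore k x.1 (fun i => O i x.2) θ₀)) (inProb P) (𝓝 0) := by
  obtain ⟨r, hr, B, hexp⟩ := h.exists_norm_expectedScore_sub_le k
  have hcons := h.tendsto_estimator h2 hΘ hindep hlaw hT hroot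
  have hδ : Tendsto (fun x => ‖T x - θ₀‖) (inProb P) (𝓝 0) :=
    tendsto_iff_norm_sub_tendsto_zero.1 hcons
  have hsq : Tendsto (fun x : ℕ × Ω => (√(x.1 : ℝ))⁻¹) (inProb P) (𝓝 0) :=
    (tendsto_inv_atTop_zero.comp (Real.tendsto_sqrt_atTop.comp
      tendsto_natCast_atTop_atTop)).comp tendsto_fst_inProb
  rw [tendsto_zero_iff_norm_tendsto_zero, Metric.tendsto_nhds]
  intro ε hε
  refine ((h2.tightEvents hΘ k).and
    (h.tightEvents_estimator hm h2 hΘ hindep hlaw hT hroot)).eventually fun M => ?_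
  have hlim : Tendsto (fun x : ℕ × Ω => M.1 * ((√(x.1 : ℝ))⁻¹ + ‖T x - θ₀‖) +
      |B| * |M.2| * ‖T x - θ₀‖) (inProb P) (𝓝 0) := by
    simpa using ((hsq.add hδ).const_mul M.1).add (hδ.const_mul (|B| * |M.2|))
  filter_upwards [hroot, hδ.eventually_lt_const hr, hlim.eventually_lt_const hε,
    tendsto_fst_inProb.eventually_ge_atTop 1] with x hx1 hx2 hx3 hx5 hG
  obtain ⟨hG1, hG2⟩ := hG
  rw [dist_zero_right, norm_norm]
  refine lt_of_le_of_lt ?_ hx3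
  have h4 := hG1 (T x) (hT x)
  rw [hx1, zero_sub, ← neg_add', norm_neg] at h4
  have h6 := hexp (T x) (by rwa [Metric.mem_ball, dist_eq_norm])
  set s := √(x.1 : ℝ)
  have hs : 0 < s := Real.sqrt_pos.2 (by exact_mod_cast hx5)
  set δ := ‖T x - θ₀‖
  have hδ0 : 0 ≤ δ := norm_nonneg _
  set Ψ := D.meanScore k x.1 (fun i => O i x.2) θ₀
  set E := D.expectedScore law θ₀ k (T x)
  set Aδ := D.expectedDeriv law θ₀ k (T x - θ₀)
  have h7 : ‖Aδ + Ψ‖ ≤ ‖Ψ + E‖ + ‖E - Aδ‖ := by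
    have := norm_sub_le (Ψ + E) (E - Aδ)
    rwa [show Ψ + E - (E - Aδ) = Aδ + Ψ by abel] at this
  rw [norm_smul, Real.norm_of_nonneg hs.le]
  -- Both errors survive multiplication by `s = √n`: the (C2) error leaves `s⁻¹ + δ`, and one factor
  -- of `δ²` is absorbed by the root-`n` rate.
  calc s * ‖Aδ + Ψ‖ ≤ s * (M.1 * (s⁻¹ * (s⁻¹ + δ)) + B * δ ^ 2) := by
        gcongr
        exact h7.trans (add_le_add h4 h6)
    _ = M.1 * (s⁻¹ + δ) + B * (s * δ) * δ := by field_simp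
    _ ≤ M.1 * (s⁻¹ + δ) + |B| * |M.2| * δ := by
        gcongr
        · exact le_abs_self B
        · exact hG2.trans (le_abs_self _)

end Sample

end Design


/-! ### Consistency of the sample sensitivity and variability at the average estimate. -/

lemma norm_mean_sub_mean_le {E : Type*} [NormedAddCommGroup E] [NormedSpace ℝ E] {n : ℕ}
    {f g : ℕ → E} {c : ℕ → ℝ} (h : ∀ i, ‖f i - g i‖ ≤ c i) :
    ‖(n : ℝ)⁻¹ • ∑ i ∈ Finset.range n, f i - (n : ℝ)⁻¹ • ∑ i ∈ Finset.range n, g i‖ ≤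
      (n : ℝ)⁻¹ * ∑ i ∈ Finset.range n, c i := by
  rw [← smul_sub, ← Finset.sum_sub_distrib, norm_smul, Real.norm_of_nonneg (by positivity)]
  gcongr
  exact (norm_sum_le _ _).trans (Finset.sum_le_sum fun i _ => h i)

/-- Perturbation of a mean of products, by the Cauchy-Schwarz inequality. -/
lemma abs_mean_mul_sub_mean_mul_le {n : ℕ} {x y x₀ y₀ d u : ℕ → ℝ} {δ : ℝ} (hδ : 0 ≤ δ)
    (hd : ∀ i, 0 ≤ d i) (hx : ∀ i, |x i - x₀ i| ≤ δ * d i) (hy : ∀ i, |y i - y₀ i| ≤ δ * d i)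
    (hx₀ : ∀ i, |x₀ i| ≤ u i) (hy₀ : ∀ i, |y₀ i| ≤ u i) :
    |(n : ℝ)⁻¹ * ∑ i ∈ Finset.range n, x i * y i
      - (n : ℝ)⁻¹ * ∑ i ∈ Finset.range n, x₀ i * y₀ i| ≤
    δ ^ 2 * ((n : ℝ)⁻¹ * ∑ i ∈ Finset.range n, d i ^ 2) +
      2 * δ * (√((n : ℝ)⁻¹ * ∑ i ∈ Finset.range n, d i ^ 2) *
        √((n : ℝ)⁻¹ * ∑ i ∈ Finset.range n, u i ^ 2)) := by
  have hterm : ∀ i ∈ Finset.range n,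
      |x i * y i - x₀ i * y₀ i| ≤ δ ^ 2 * d i ^ 2 + 2 * δ * (d i * u i) := fun i _ => by
    have hu : 0 ≤ u i := (abs_nonneg _).trans (hx₀ i)
    have hδd : 0 ≤ δ * d i := mul_nonneg hδ (hd i)
    calc |x i * y i - x₀ i * y₀ i|
        = |(x i - x₀ i) * (y i - y₀ i) + (x i - x₀ i) * y₀ i + x₀ i * (y i - y₀ i)| := by
          congr 1; ring
      _ ≤ |x i - x₀ i| * |y i - y₀ i| + |x i - x₀ i| * |y₀ i| + |x₀ i| * |y i - y₀ i| := by
          rw [← abs_mul, ← abs_mul, ← abs_mul]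
          exact abs_add_three _ _ _
      _ ≤ (δ * d i) * (δ * d i) + (δ * d i) * u i + u i * (δ * d i) := by
          gcongr
          · exact hx i
          · exact hy i
          · exact hx i
          · exact hy₀ i
          · exact hx₀ i
          · exact hy i
      _ = _ := by ring
  have hn : (0 : ℝ) ≤ (n : ℝ)⁻¹ := by positivity
  have hcs := Real.sum_mul_le_sqrt_mul_sqrt (Finset.range n) d u
  rw [← mul_sub, ← Finset.sum_sub_distrib, abs_mul, abs_of_nonneg hn, Real.sqrt_mul hn,
    Real.sqrt_mul hn]
  calc (n : ℝ)⁻¹ * |∑ i ∈ Finset.range n, (x i * y i - x₀ i * y₀ i)|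
      ≤ (n : ℝ)⁻¹ * ∑ i ∈ Finset.range n, (δ ^ 2 * d i ^ 2 + 2 * δ * (d i * u i)) := by
        gcongr
        exact (Finset.abs_sum_le_sum_abs _ _).trans (Finset.sum_le_sum hterm)
    _ = δ ^ 2 * ((n : ℝ)⁻¹ * ∑ i ∈ Finset.range n, d i ^ 2) +
        2 * δ * ((n : ℝ)⁻¹ * ∑ i ∈ Finset.range n, d i * u i) := by
        rw [Finset.sum_add_distrib, ← Finset.mul_sum, ← Finset.mul_sum]; ring
    _ ≤ δ ^ 2 * ((n : ℝ)⁻¹ * ∑ i ∈ Finset.range n, d i ^ 2) +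
        2 * δ * ((n : ℝ)⁻¹ * (√(∑ i ∈ Finset.range n, d i ^ 2) *
          √(∑ i ∈ Finset.range n, u i ^ 2))) := by gcongr
    _ = _ := by
        have h1 : (n : ℝ)⁻¹ = √(n : ℝ)⁻¹ * √(n : ℝ)⁻¹ := (Real.mul_self_sqrt hn).symm
        generalize hw : √(n : ℝ)⁻¹ = w at h1 ⊢
        rw [h1]; ring

namespace Design

variable {d K q : ℕ} {D : Design d K q} {law : D.Param → Measure (Obs d q)} {Θ : Set D.Param}
  {supp : Set (Obs d q)} {θ₀ : D.Param} {covLaw : Measure (Covariates d q)}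
  {Ω : Type*} [MeasurableSpace Ω] {P : Measure Ω} [IsProbabilityMeasure P]
  {O : ℕ → Ω → Obs d q}

lemma ConditionC1.fderiv_meanScore (h : D.ConditionC1 law Θ supp θ₀) {x : ℕ → Obs d q}
    (hx : ∀ i, x i ∈ supp) {θ : D.Param} (hθ : θ ∈ Θ) (k : Fin K) (n : ℕ) :
    fderiv ℝ (D.meanScore k n x) θ =
      (n : ℝ)⁻¹ • ∑ i ∈ Finset.range n, fderiv ℝ (D.score k (x i)) θ := by
  have hd : ∀ i ∈ Finset.range n, HasFDerivAt (D.score k (x i))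
      (fderiv ℝ (D.score k (x i)) θ) θ := fun i _ =>
    ((h.score_contDiffAt (hx i) hθ k).differentiableAt (by norm_num)).hasFDerivAt
  exact ((HasFDerivAt.fun_sum hd).const_smul (n : ℝ)⁻¹).fderiv

/-- The derivative of the mean score is consistent at consistent estimates. -/
lemma ConditionC1.tendsto_fderiv_meanScore (h : D.ConditionC1 law Θ supp θ₀)
    (hindep : iIndepFun O P) (hlaw : ∀ i, HasLaw (O i) (law θ₀) P) (k : Fin K)
    {T : ℕ × Ω → D.Param} (hT : Tendsto T (inProb P) (𝓝 θ₀)) :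
    Tendsto (fun x : ℕ × Ω => fderiv ℝ (D.meanScore k x.1 (fun i => O i x.2)) (T x)) (inProb P)
      (𝓝 (D.expectedDeriv law θ₀ k)) := by
  obtain ⟨r, hr, b, hb, hball, hbound⟩ := h.exists_ball
  have : ProperSpace (D.Param →L[ℝ] D.Param) := FiniteDimensional.proper ℝ _
  have hlln := tendsto_mean_inProb hindep hlaw (h.sensitivity_finite k)
  have hb' := tendsto_mean_inProb hindep hlaw hb
  have hδ : Tendsto (fun x => ‖T x - θ₀‖) (inProb P) (𝓝 0) :=
    tendsto_iff_norm_sub_tendsto_zero.1 hT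
  have hprod := hb'.mul hδ
  rw [mul_zero] at hprod
  have hdiff : Tendsto (fun x : ℕ × Ω =>
      fderiv ℝ (D.meanScore k x.1 (fun i => O i x.2)) (T x) -
      (x.1 : ℝ)⁻¹ • ∑ i ∈ Finset.range x.1, fderiv ℝ (D.score k (O i x.2)) θ₀) (inProb P)
      (𝓝 0) := by
    refine squeeze_zero_norm' ?_ hprod
    filter_upwards [h.eventually_mem_supp hlaw, hT.eventually (Metric.ball_mem_nhds θ₀ hr)]
      with x hx hTx
    rw [h.fderiv_meanScore hx (hball hTx), smul_eq_mul, mul_assoc, Finset.sum_mul]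
    refine norm_mean_sub_mean_le fun i => ?_
    exact norm_fderiv_sub_le_of_ball (fun y hy => h.score_contDiffAt (hx i) (hball hy) k)
      (fun y hy => hbound _ (hx i) y hy k) hTx
  simpa [expectedDeriv] using hdiff.add hlln

lemma ConditionC1.sensitivity_apply (h : D.ConditionC1 law Θ supp θ₀) (k : Fin K)
    (a b : D.Idx) :
    D.sensitivity law k θ₀ a b = D.expectedDeriv law θ₀ k (EuclideanSpace.single b 1) a := by
  have h1 := (h.sensitivity_finite k).apply_continuousLinearMap
    (EuclideanSpace.single b (1 : ℝ) : D.Param)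
  rw [expectedDeriv, ContinuousLinearMap.integral_apply (h.sensitivity_finite k)]
  exact ((EuclideanSpace.proj (𝕜 := ℝ) a).integral_comp_comm h1)

lemma ConditionC1.tendsto_sampleSensitivity (h : D.ConditionC1 law Θ supp θ₀)
    (hindep : iIndepFun O P) (hlaw : ∀ i, HasLaw (O i) (law θ₀) P) (k : Fin K)
    {T : ℕ × Ω → D.Param} (hT : Tendsto T (inProb P) (𝓝 θ₀)) :
    Tendsto (fun x : ℕ × Ω => D.sampleSensitivity k x.1 (fun i => O i x.2) (T x)) (inProb P)
      (𝓝 (D.sensitivity law k θ₀)) := by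
  refine tendsto_pi_nhds.2 fun a => tendsto_pi_nhds.2 fun b => ?_
  rw [h.sensitivity_apply]
  have hc : Continuous fun A : D.Param →L[ℝ] D.Param => A (EuclideanSpace.single b 1) a := by
    fun_prop
  exact (hc.tendsto _).comp (h.tendsto_fderiv_meanScore hindep hlaw k hT)

/-- The sample variability is consistent at root-`n` consistent estimates. -/
lemma ConditionC1.tendsto_sampleVariability (hm : D.IsModel law Θ covLaw)
    (h : D.ConditionC1 law Θ supp θ₀)
    (hindep : iIndepFun O P) (hlaw : ∀ i, HasLaw (O i) (law θ₀) P)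
    {T : ℕ × Ω → D.Param} (hT : Tendsto T (inProb P) (𝓝 θ₀))
    (htight : TightEvents P (fun (M : ℝ) x => √(x.1 : ℝ) * ‖T x - θ₀‖ ≤ M)) :
    Tendsto (fun x : ℕ × Ω => D.sampleVariability x.1 (fun i => O i x.2) (T x)) (inProb P)
      (𝓝 (D.variability law θ₀)) := by
  have hprob := hm.prob θ₀ h.mem
  obtain ⟨r, hr, β, hβ, hball, hbound⟩ := h.exists_ball
  refine tendsto_pi_nhds.2 fun a => tendsto_pi_nhds.2 fun b => ?_
  -- convergence at the true value
  have hlln := tendsto_mean_inProb hindep hlaw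
    (F := fun o => D.score a.1 o θ₀ a.2 * D.score b.1 o θ₀ b.2)
    ((h.memLp_score_apply a).integrable_mul (h.memLp_score_apply b))
  rw [← h.variability_apply hm] at hlln
  -- the Lipschitz modulus of the scores and the size of the scores
  set m : Obs d q → ℝ := fun o => ∑ k, ‖fderiv ℝ (D.score k o) θ₀‖ + r * |β o|
  set u : Obs d q → ℝ := fun o => ∑ k, ‖D.score k o θ₀‖
  have hm0 : ∀ o, 0 ≤ m o := fun o => by positivity
  have hmint : Integrable m (law θ₀) :=
    (integrable_finsetSum _ fun k _ => (h.sensitivity_finite k).norm).add (hβ.abs.const_mul r)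
  have huint : Integrable (fun o => u o ^ 2) (law θ₀) :=
    (memLp_finsetSum _ fun k _ => (h.memLp_score k).norm).integrable_sq
  -- The modulus `m` is merely integrable, so the mean of `m²` may diverge. The extra `n⁻¹`,
  -- supplied later by `δ² ≤ M² / n`, makes it vanish.
  have hq : Tendsto (fun x : ℕ × Ω => (x.1 : ℝ)⁻¹ *
      ((x.1 : ℝ)⁻¹ * ∑ i ∈ Finset.range x.1, m (O i x.2) ^ 2)) (inProb P) (𝓝 0) := by
    refine tendsto_inProb_of_ae (X := fun n ω => (n : ℝ)⁻¹ *
      ((n : ℝ)⁻¹ * ∑ i ∈ Finset.range n, m (O i ω) ^ 2)) (fun n => ?_) ?_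
    · exact (aestronglyMeasurable_mean hlaw (hmint.aestronglyMeasurable.pow 2) n).const_mul _
    · filter_upwards [tendsto_mean_ae hindep hlaw hmint] with ω hω
      exact tendsto_mean_sq_div (fun n => hm0 _) hω
  have hp := tendsto_mean_inProb hindep hlaw huint
  have hdiff : Tendsto (fun x : ℕ × Ω =>
      D.sampleVariability x.1 (fun i => O i x.2) (T x) a b -
      (x.1 : ℝ)⁻¹ • ∑ i ∈ Finset.range x.1,
        D.score a.1 (O i x.2) θ₀ a.2 * D.score b.1 (O i x.2) θ₀ b.2) (inProb P) (𝓝 0) := by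
    rw [Metric.tendsto_nhds]
    intro ε hε
    refine htight.eventually fun M => ?_
    have hlim := (hq.const_mul (M ^ 2)).add
      (((hq.sqrt).mul hp.sqrt).const_mul (2 * M))
    rw [Real.sqrt_zero, zero_mul, mul_zero, mul_zero, add_zero] at hlim
    filter_upwards [hlim.eventually_lt_const hε, h.eventually_mem_supp hlaw,
      hT.eventually (Metric.ball_mem_nhds θ₀ hr), tendsto_fst_inProb.eventually_ge_atTop 1]
      with x hx1 hx2 hx3 hx4 hM
    rw [dist_zero_right]
    refine lt_of_le_of_lt ?_ hx1
    have hn : (0 : ℝ) < x.1 := by exact_mod_cast hx4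
    set δ := ‖T x - θ₀‖
    have hδr : δ < r := by simpa [dist_eq_norm] using hx3
    have hlip : ∀ (c : Fin K × D.Idx) (i : ℕ),
        |D.score c.1 (O i x.2) (T x) c.2 - D.score c.1 (O i x.2) θ₀ c.2| ≤ δ * m (O i x.2) := by
      intro c i
      have h1 := norm_sub_sub_fderiv_le_of_ball
        (fun y hy => h.score_contDiffAt (hx2 i) (hball hy) c.1)
        (fun y hy => hbound _ (hx2 i) y hy c.1) hx3
      have h2 := (fderiv ℝ (D.score c.1 (O i x.2)) θ₀).le_opNorm (T x - θ₀)
      have h3 := norm_le_norm_sub_add (D.score c.1 (O i x.2) (T x) - D.score c.1 (O i x.2) θ₀)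
        (fderiv ℝ (D.score c.1 (O i x.2)) θ₀ (T x - θ₀))
      have h4 := PiLp.norm_apply_le (D.score c.1 (O i x.2) (T x) - D.score c.1 (O i x.2) θ₀) c.2
      have h5 : ‖fderiv ℝ (D.score c.1 (O i x.2)) θ₀‖ ≤
          ∑ k, ‖fderiv ℝ (D.score k (O i x.2)) θ₀‖ :=
        Finset.single_le_sum (f := fun k => ‖fderiv ℝ (D.score k (O i x.2)) θ₀‖)
          (fun _ _ => norm_nonneg _) (Finset.mem_univ c.1)
      refine (show _ ≤ _ from h4).trans (h3.trans ((add_le_add h1 h2).trans ?_))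
      -- Since `δ < r`, the quadratic remainder becomes part of a linear Lipschitz bound.
      have h6 : β (O i x.2) * δ ^ 2 ≤ r * |β (O i x.2)| * δ := by
        calc β (O i x.2) * δ ^ 2 ≤ |β (O i x.2)| * (r * δ) := by
              rw [sq]
              gcongr
              exact le_abs_self _
          _ = _ := by ring
      have h7 := mul_le_mul_of_nonneg_right h5 (norm_nonneg (T x - θ₀))
      simp only [m]
      change β (O i x.2) * δ ^ 2 + _ * δ ≤ δ * _
      change _ * δ ≤ _ * δ at h7
      linarith
    have hsize : ∀ (c : Fin K × D.Idx) (i : ℕ), |D.score c.1 (O i x.2) θ₀ c.2| ≤ u (O i x.2) :=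
      fun c i => (show _ ≤ _ from PiLp.norm_apply_le (D.score c.1 (O i x.2) θ₀) c.2).trans
        (Finset.single_le_sum (f := fun k => ‖D.score k (O i x.2) θ₀‖)
          (fun _ _ => norm_nonneg _) (Finset.mem_univ c.1))
    refine (abs_mean_mul_sub_mean_mul_le (n := x.1) (δ := δ) (norm_nonneg _)
      (fun i => hm0 (O i x.2)) (hlip a) (hlip b) (hsize a) (hsize b)).trans ?_
    set Q := (x.1 : ℝ)⁻¹ * ∑ i ∈ Finset.range x.1, m (O i x.2) ^ 2
    have hQ : 0 ≤ Q := by positivity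
    have hδM : δ ≤ M * (√(x.1 : ℝ))⁻¹ := by
      rw [← div_eq_mul_inv, le_div_iff₀ (Real.sqrt_pos.2 hn), mul_comm]
      exact hM
    have hM0 : 0 ≤ M := le_trans (by positivity) hM
    have hδ2 : δ ^ 2 ≤ M ^ 2 * (x.1 : ℝ)⁻¹ := by
      calc δ ^ 2 ≤ (M * (√(x.1 : ℝ))⁻¹) ^ 2 := by gcongr
        _ = _ := by rw [mul_pow, inv_pow, Real.sq_sqrt hn.le]
    rw [Real.sqrt_mul (inv_nonneg.2 hn.le) Q, Real.sqrt_inv]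
    refine add_le_add ?_ ?_
    · calc δ ^ 2 * Q ≤ M ^ 2 * (x.1 : ℝ)⁻¹ * Q := by gcongr
        _ = _ := by ring
    · simp only [smul_eq_mul]
      calc _ ≤ 2 * (M * (√(x.1 : ℝ))⁻¹) * (√Q *
            √((x.1 : ℝ)⁻¹ * ∑ i ∈ Finset.range x.1, u (O i x.2) ^ 2)) := by gcongr
        _ = _ := by ring
  simpa using hdiff.add hlln

end Design


/-! ### Limit matrices and the influence function. -/

open scoped Matrix

lemma tendsto_matrix_inv {α n : Type*} [Fintype n] [DecidableEq n] {l : Filter α}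
    {A : α → Matrix n n ℝ} {B : Matrix n n ℝ} (hA : Tendsto A l (𝓝 B)) (hB : IsUnit B.det) :
    Tendsto (fun x => (A x)⁻¹) l (𝓝 B⁻¹) := by
  refine (continuousAt_matrix_inv B ?_).tendsto.comp hA
  obtain ⟨u, hu⟩ := hB
  rw [← hu]
  exact NormedRing.inverse_continuousAt u

lemma eventually_isUnit_det {α n : Type*} [Fintype n] [DecidableEq n] {l : Filter α}
    {A : α → Matrix n n ℝ} {B : Matrix n n ℝ} (hA : Tendsto A l (𝓝 B)) (hB : IsUnit B.det) :
    ∀ᶠ x in l, IsUnit (A x).det := by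
  have h1 : Tendsto (fun x => (A x).det) l (𝓝 B.det) :=
    ((continuous_id.matrix_det).tendsto B).comp hA
  filter_upwards [h1.eventually_ne hB.ne_zero] with x hx using hx.isUnit

lemma tendsto_matrix_transpose {α m n : Type*} {l : Filter α}
    {A : α → Matrix m n ℝ} {B : Matrix m n ℝ} (hA : Tendsto A l (𝓝 B)) :
    Tendsto (fun x => (A x)ᵀ) l (𝓝 Bᵀ) :=
  ((continuous_id.matrix_transpose).tendsto B).comp hA

lemma continuous_toEuclideanCLM {ι : Type*} [Fintype ι] [DecidableEq ι] :
    Continuous (fun A : Matrix ι ι ℝ => Matrix.toEuclideanCLM (n := ι) (𝕜 := ℝ) A) :=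
  LinearMap.continuous_of_finiteDimensional
    ((Matrix.toEuclideanCLM (n := ι) (𝕜 := ℝ)).toAlgEquiv.toLinearMap)

namespace Design

variable {d K q : ℕ} {D : Design d K q} {law : D.Param → Measure (Obs d q)} {Θ : Set D.Param}
  {supp : Set (Obs d q)} {θ₀ : D.Param} {covLaw : Measure (Covariates d q)}

lemma ConditionC1.toEuclideanCLM_sensitivity (h : D.ConditionC1 law Θ supp θ₀) (k : Fin K) :
    Matrix.toEuclideanCLM (n := D.Idx) (𝕜 := ℝ) (D.sensitivity law k θ₀) =
      D.expectedDeriv law θ₀ k := by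
  refine ContinuousLinearMap.coe_injective ((EuclideanSpace.basisFun D.Idx ℝ).toBasis.ext
    fun b => ?_)
  ext a
  simp only [ContinuousLinearMap.coe_coe, OrthonormalBasis.coe_toBasis,
    EuclideanSpace.basisFun_apply]
  rw [← h.sensitivity_apply, Matrix.ofLp_toEuclideanCLM]
  simp

/-- The weights `h⁻¹ i_kᵀ {c⁻¹}_{k,k}` of the regional scores in the limit. -/
noncomputable def scoreWeight (D : Design d K q) (law : D.Param → Measure (Obs d q))
    (θ : D.Param) (k : Fin K) : Matrix D.Idx D.Idx ℝ :=
  (D.asympBread law θ)⁻¹ * (D.sensitivity law k θ)ᵀ * D.block (D.variability law θ)⁻¹ k k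

/-- The regional weights, side by side. -/
noncomputable def stackedWeight (D : Design d K q) (law : D.Param → Measure (Obs d q))
    (θ : D.Param) : Matrix D.Idx (Fin K × D.Idx) ℝ :=
  Matrix.of fun a b => D.scoreWeight law θ b.1 a b.2

lemma ConditionC1.isUnit_det_variability (h : D.ConditionC1 law Θ supp θ₀) :
    IsUnit (D.variability law θ₀).det :=
  (h.variability_posDef θ₀ h.mem).det_pos.ne'.isUnit

/-- Diagonal blocks of the positive definite `c⁻¹` are positive definite, and congruence by the
injective `i_k` preserves this. At least one region makes the sum positive definite. -/
lemma ConditionC1.isUnit_det_asympBread (hK : 0 < K) (hm : D.IsModel law Θ covLaw)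
    (h : D.ConditionC1 law Θ supp θ₀) : IsUnit (D.asympBread law θ₀).det := by
  have hterm : ∀ k, ((D.sensitivity law k θ₀)ᵀ * D.block (D.variability law θ₀)⁻¹ k k
      * D.sensitivity law k θ₀).PosDef := fun k => by
    have hblock : (D.block (D.variability law θ₀)⁻¹ k k).PosDef :=
      (h.variability_posDef θ₀ h.mem).inv.submatrix (Prod.mk_right_injective k)
    have hinj : Function.Injective (D.sensitivity law k θ₀).mulVec := by
      obtain ⟨c, hc, hlow⟩ := hm.exists_le_norm_expectedDeriv h k
      intro v w hvw
      have h1 : D.expectedDeriv law θ₀ k (WithLp.toLp 2 (v - w)) = 0 := by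
        rw [← h.toEuclideanCLM_sensitivity, Matrix.toEuclideanCLM_toLp, Matrix.mulVec_sub]
        rw [show D.sensitivity law k θ₀ *ᵥ v = D.sensitivity law k θ₀ *ᵥ w from hvw, sub_self]
        rfl
      have h2 := hlow (WithLp.toLp 2 (v - w))
      rw [h1, norm_zero] at h2
      have h3 : ‖(WithLp.toLp 2 (v - w) : D.Param)‖ = 0 :=
        le_antisymm (by nlinarith) (norm_nonneg _)
      have h4 := congrArg WithLp.ofLp (norm_eq_zero.1 h3)
      exact sub_eq_zero.1 h4
    simpa using hblock.conjTranspose_mul_mul_same hinj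
  have hsum : (D.asympBread law θ₀).PosDef := by
    have : Nonempty (Fin K) := ⟨⟨0, hK⟩⟩
    rw [asympBread, ← Finset.add_sum_erase _ _ (Finset.mem_univ (Classical.arbitrary (Fin K)))]
    exact (hterm _).add_posSemidef (Matrix.posSemidef_sum _ fun k _ => (hterm k).posSemidef)
  exact hsum.det_pos.ne'.isUnit

/-- The double sum over regions is a block product. In this form the sandwich is visibly the
covariance of a linear image of the stacked score, hence positive semidefinite. -/
lemma ConditionC1.asympCov_eq (h : D.ConditionC1 law Θ supp θ₀) :
    D.asympCov law θ₀ =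
      D.stackedWeight law θ₀ * D.variability law θ₀ * (D.stackedWeight law θ₀)ᵀ := by
  have hsymm : ∀ k, (D.block (D.variability law θ₀)⁻¹ k k)ᵀ = D.block (D.variability law θ₀)⁻¹ k k :=
    fun k => by
      have := ((h.variability_posDef θ₀ h.mem).inv.submatrix
        (Prod.mk_right_injective (β := D.Idx) k)).isHermitian
      simpa [Matrix.IsHermitian, block] using this
  have hblocks : D.stackedWeight law θ₀ * D.variability law θ₀ * (D.stackedWeight law θ₀)ᵀ =
      ∑ k, ∑ k', D.scoreWeight law θ₀ k * D.block (D.variability law θ₀) k k'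
        * (D.scoreWeight law θ₀ k')ᵀ := by
    ext a b
    simp only [Matrix.mul_apply, Matrix.sum_apply, stackedWeight, block, Matrix.transpose_apply,
      Matrix.of_apply, Matrix.submatrix_apply, Fintype.sum_prod_type, Finset.sum_mul]
    rw [Finset.sum_comm (γ := Fin K) (s := (Finset.univ : Finset (Fin K)))
      (t := (Finset.univ : Finset (Fin K)))]
    refine Finset.sum_congr rfl fun k' _ => ?_
    rw [Finset.sum_comm]
  rw [hblocks, asympCov, asympMeat]
  simp only [Finset.mul_sum, Finset.sum_mul]
  refine Finset.sum_congr rfl fun k _ => Finset.sum_congr rfl fun k' _ => ?_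
  rw [scoreWeight, scoreWeight, Matrix.transpose_mul, Matrix.transpose_mul, hsymm,
    Matrix.transpose_transpose, Matrix.transpose_nonsing_inv]
  simp only [Matrix.mul_assoc]

lemma ConditionC1.posSemidef_asympCov (h : D.ConditionC1 law Θ supp θ₀) :
    (D.asympCov law θ₀).PosSemidef := by
  rw [h.asympCov_eq]
  simpa using (h.variability_posDef θ₀ h.mem).posSemidef.mul_mul_conjTranspose_same
    (D.stackedWeight law θ₀)

/-- The influence function of the meta-estimator. -/
noncomputable def influence (D : Design d K q) (law : D.Param → Measure (Obs d q))
    (θ₀ : D.Param) (o : Obs d q) : D.Param :=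
  -∑ k, Matrix.toEuclideanCLM (n := D.Idx) (𝕜 := ℝ) (D.scoreWeight law θ₀ k) (D.score k o θ₀)

lemma ConditionC1.memLp_influence (h : D.ConditionC1 law Θ supp θ₀) :
    MemLp (D.influence law θ₀) 2 (law θ₀) := by
  have hk : ∀ k, MemLp (fun o => Matrix.toEuclideanCLM (n := D.Idx) (𝕜 := ℝ)
      (D.scoreWeight law θ₀ k) (D.score k o θ₀)) 2 (law θ₀) := fun k =>
    (h.memLp_score k).continuousLinearMap_comp
      (Matrix.toEuclideanCLM (n := D.Idx) (𝕜 := ℝ) (D.scoreWeight law θ₀ k))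
  exact (memLp_finsetSum _ fun k _ => hk k).neg

lemma ConditionC1.integral_influence (h : D.ConditionC1 law Θ supp θ₀) :
    ∫ o, D.influence law θ₀ o ∂(law θ₀) = 0 := by
  have hint := fun k => h.integrable_score θ₀ h.mem k
  unfold influence
  rw [integral_neg, integral_finsetSum _ fun k _ => ContinuousLinearMap.integrable_comp _ (hint k)]
  rw [Finset.sum_eq_zero, neg_zero]
  intro k _
  rw [ContinuousLinearMap.integral_comp_comm _ (hint k), h.integral_score, map_zero]

open scoped RealInnerProductSpace in
lemma ConditionC1.integral_inner_influence_sq (hm : D.IsModel law Θ covLaw)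
    (h : D.ConditionC1 law Θ supp θ₀) (t : D.Param) :
    ∫ o, ⟪D.influence law θ₀ o, t⟫ ^ 2 ∂(law θ₀) = t ⬝ᵥ D.asympCov law θ₀ *ᵥ t := by
  have hinner : ∀ o, ⟪D.influence law θ₀ o, t⟫ =
      -∑ a, ((D.stackedWeight law θ₀)ᵀ *ᵥ t) a * D.score a.1 o θ₀ a.2 := fun o => by
    rw [influence, inner_neg_left, sum_inner, Fintype.sum_prod_type]
    congr 1
    refine Finset.sum_congr rfl fun k _ => ?_
    rw [real_inner_comm, Matrix.inner_toEuclideanCLM]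
    simp only [dotProduct, Matrix.mulVec, stackedWeight, Matrix.transpose_apply, Matrix.of_apply,
      Finset.mul_sum, Finset.sum_mul]
    rw [Finset.sum_comm]
    refine Finset.sum_congr rfl fun b _ => Finset.sum_congr rfl fun a _ => ?_
    ring
  simp only [hinner, neg_sq]
  rw [h.integral_sum_sq hm, h.asympCov_eq, ← Matrix.mulVec_mulVec, ← Matrix.mulVec_mulVec,
    Matrix.dotProduct_mulVec t (D.stackedWeight law θ₀), ← Matrix.mulVec_transpose]

lemma mean_influence {n : ℕ} {x : ℕ → Obs d q} :
    (n : ℝ)⁻¹ • ∑ i ∈ Finset.range n, D.influence law θ₀ (x i) =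
      -∑ k, Matrix.toEuclideanCLM (n := D.Idx) (𝕜 := ℝ) (D.scoreWeight law θ₀ k)
        (D.meanScore k n x θ₀) := by
  simp only [influence, meanScore, map_smul, map_sum, Finset.sum_neg_distrib, smul_neg]
  rw [Finset.sum_comm, Finset.smul_sum]

end Design


/-! ### Algebra of the meta-estimate. -/

namespace Design

variable {d K q : ℕ} {D : Design d K q}

/-- The contribution `I_kᵀ W_k I_k` of the region `k` to `H`. -/
noncomputable def regionBread (D : Design d K q) (k : Fin K) (n : ℕ) (x : ℕ → Obs d q)
    (θ : D.Param) : Matrix D.Idx D.Idx ℝ :=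
  (D.sampleSensitivity k n x θ)ᵀ * D.weight k n x θ * D.sampleSensitivity k n x θ

/-- The error of the meta-estimate is a matrix-weighted mean of the errors of the regional
estimates. -/
lemma metaEstimate_sub {n : ℕ} {x : ℕ → Obs d q} {t : Fin K → D.Param}
    (hH : IsUnit (D.bread n x (D.averageEstimate t)).det) (θ₀ : D.Param) :
    D.metaEstimate n x t - θ₀ = ∑ k, Matrix.toEuclideanCLM (n := D.Idx) (𝕜 := ℝ)
      ((D.bread n x (D.averageEstimate t))⁻¹ * D.regionBread k n x (D.averageEstimate t))
      (t k - θ₀) := by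
  set θ := D.averageEstimate t
  have h1 : D.metaEstimate n x t = ∑ k, Matrix.toEuclideanCLM (n := D.Idx) (𝕜 := ℝ)
      ((D.bread n x θ)⁻¹ * D.regionBread k n x θ) (t k) := by
    have h2 : ∀ k, Matrix.toEuclideanCLM (n := D.Idx) (𝕜 := ℝ)
        ((D.bread n x θ)⁻¹ * D.regionBread k n x θ) (t k) =
        WithLp.toLp 2 ((D.bread n x θ)⁻¹ *ᵥ (D.regionBread k n x θ *ᵥ (t k))) := fun k => by
      rw [Matrix.mulVec_mulVec]
      rfl
    rw [Finset.sum_congr rfl fun k _ => h2 k, ← WithLp.toLp_sum, ← Matrix.mulVec_sum]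
    rfl
  -- The matrix weights sum to `H⁻¹ H = 1`, so `θ₀` can be subtracted inside the sum.
  have h3 : ∑ k, Matrix.toEuclideanCLM (n := D.Idx) (𝕜 := ℝ)
      ((D.bread n x θ)⁻¹ * D.regionBread k n x θ) θ₀ = θ₀ := by
    rw [← sum_apply, ← map_sum, ← Finset.mul_sum,
      show ∑ k, D.regionBread k n x θ = D.bread n x θ from rfl, Matrix.nonsing_inv_mul _ hH,
      map_one, one_apply_eq_self]
  rw [h1]
  conv_lhs => rw [← h3]
  rw [← Finset.sum_sub_distrib]
  simp only [map_sub]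

end Design

end SpatialExtremes

/-! ### Assembly: Slutsky's lemma for the weighted mean of the regional errors. -/

theorem theorem3 {d K q : ℕ} (hK : 0 < K) (D : Design d K q)
    -- parameter space, true value, law of the covariates, law of one replicate, common support
    (Θ : Set D.Param) (hΘ : IsCompact Θ) (θ₀ : D.Param)
    (covLaw : Measure (Covariates d q)) (law : D.Param → Measure (Obs d q))
    (supp : Set (Obs d q))
    (hmodel : D.IsModel law Θ covLaw)
    (hC1 : D.ConditionC1 law Θ supp θ₀)
    -- independent replicates under the true value
    {Ω : Type*} [MeasurableSpace Ω] (P : Measure Ω) [IsProbabilityMeasure P]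
    (O : ℕ → Ω → Obs d q) (hindep : iIndepFun O P) (hlaw : ∀ i, HasLaw (O i) (law θ₀) P)
    (hC2 : D.ConditionC2 law Θ θ₀ P O)
    -- the regional estimators solve the score equations, with probability tending to one
    (est : ℕ → Fin K → Ω → D.Param) (hest_meas : ∀ n k, AEMeasurable (est n k) P)
    (hest_mem : ∀ n k ω, est n k ω ∈ Θ)
    (hest_root : ∀ k, Tendsto
      (fun n => P {ω | D.meanScore k n (fun i => O i ω) (est n k ω) ≠ 0}) atTop (𝓝 0))
    -- the average of the regional estimators, and the meta-estimator
    (avg : ℕ → Ω → D.Param) (havg : ∀ n ω, avg n ω = D.averageEstimate (fun k => est n k ω))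
    (metaEst : ℕ → Ω → D.Param)
    (hmeta : ∀ n ω, metaEst n ω = D.metaEstimate n (fun i => O i ω) (fun k => est n k ω))
    (hmeta_meas : ∀ n, AEMeasurable (metaEst n) P) :
    -- the matrices to be inverted are nonsingular, with probability tending to one in the sample
    Tendsto (fun n => P {ω | ¬ (IsUnit (D.sampleVariability n (fun i => O i ω) (avg n ω)).det ∧
        IsUnit (D.bread n (fun i => O i ω) (avg n ω)).det)}) atTop (𝓝 0) ∧
    IsUnit (D.asympBread law θ₀).det ∧ (D.asympCov law θ₀).PosSemidef ∧
    -- consistency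
    TendstoInMeasure P metaEst atTop (fun _ => θ₀) ∧
    -- asymptotic normality
    TendstoInDistribution (fun (n : ℕ) ω => √(n : ℝ) • (metaEst n ω - θ₀)) atTop
      (id : D.Param → D.Param) (fun _ => P) (multivariateGaussian 0 (D.asympCov law θ₀)) ∧
    -- consistency of the covariance estimator
    (∀ a b, TendstoInMeasure P
      (fun (n : ℕ) ω => (n : ℝ) * D.covEstimate n (fun i => O i ω) (avg n ω) a b) atTop
      (fun _ => D.asympCov law θ₀ a b)) := by
  have hprob := hmodel.prob θ₀ hC1.mem
  have hroot : ∀ k, ∀ᶠ x in inProb P,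
      D.meanScore k x.1 (fun i => O i x.2) (est x.1 k x.2) = 0 := fun k =>
    eventually_inProb.2 (hest_root k)
  have hcons : ∀ k, Tendsto (fun x : ℕ × Ω => est x.1 k x.2) (inProb P) (𝓝 θ₀) := fun k =>
    hC1.tendsto_estimator hC2 hΘ hindep hlaw (fun x => hest_mem _ _ _) (hroot k)
  have hrate : ∀ k, TightEvents P (fun (M : ℝ) x => √(x.1 : ℝ) * ‖est x.1 k x.2 - θ₀‖ ≤ M) :=
    fun k => hC1.tightEvents_estimator hmodel hC2 hΘ hindep hlaw (fun x => hest_mem _ _ _)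
      (hroot k)
  have hlin : ∀ k, Tendsto (fun x : ℕ × Ω => √(x.1 : ℝ) •
      (D.expectedDeriv law θ₀ k (est x.1 k x.2 - θ₀) +
        D.meanScore k x.1 (fun i => O i x.2) θ₀)) (inProb P) (𝓝 0) := fun k =>
    hC1.tendsto_linearization hmodel hC2 hΘ hindep hlaw (fun x => hest_mem _ _ _) (hroot k)
  have hK' : (K : ℝ) ≠ 0 := by positivity
  -- the average of the regional estimators
  have havg_sub : ∀ n ω, avg n ω - θ₀ = (K : ℝ)⁻¹ • ∑ k, (est n k ω - θ₀) := fun n ω => by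
    rw [havg, Design.averageEstimate, Finset.sum_sub_distrib, smul_sub]
    simp [← Nat.cast_smul_eq_nsmul ℝ, smul_smul, hK']
  have havg_cons : Tendsto (fun x : ℕ × Ω => avg x.1 x.2) (inProb P) (𝓝 θ₀) := by
    rw [tendsto_iff_norm_sub_tendsto_zero, ← tendsto_zero_iff_norm_tendsto_zero]
    simp only [havg_sub]
    have := (tendsto_finsetSum Finset.univ fun k _ => (hcons k).sub_const θ₀).const_smul (K : ℝ)⁻¹
    simpa using this
  have havg_rate : TightEvents P (fun (M : ℝ) x => √(x.1 : ℝ) * ‖avg x.1 x.2 - θ₀‖ ≤ M) := by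
    refine TightEvents.le_sum hrate fun x => ?_
    rw [havg_sub, norm_smul, ← Finset.mul_sum]
    gcongr
    have h1 : ‖(K : ℝ)⁻¹‖ ≤ 1 := by
      rw [norm_inv, Real.norm_natCast]
      exact inv_le_one_of_one_le₀ (by exact_mod_cast hK)
    exact (mul_le_of_le_one_left (norm_nonneg _) h1).trans (norm_sum_le _ _)
  -- consistency of the sample matrices
  have hS := fun k => hC1.tendsto_sampleSensitivity hindep hlaw k havg_cons
  have hC := hC1.tendsto_sampleVariability hmodel hindep hlaw havg_cons havg_rate
  have hCinv := tendsto_matrix_inv hC hC1.isUnit_det_variability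
  have hblock : ∀ {A : ℕ × Ω → Matrix (Fin K × D.Idx) (Fin K × D.Idx) ℝ} {B},
      Tendsto A (inProb P) (𝓝 B) → ∀ k k',
      Tendsto (fun x => D.block (A x) k k') (inProb P) (𝓝 (D.block B k k')) :=
    fun hA k k' => ((continuous_id.matrix_submatrix (Prod.mk k) (Prod.mk k')).tendsto _).comp hA
  have hW : ∀ k, Tendsto (fun x : ℕ × Ω => D.weight k x.1 (fun i => O i x.2) (avg x.1 x.2))
      (inProb P) (𝓝 (D.block (D.variability law θ₀)⁻¹ k k)) := fun k => hblock hCinv k k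
  have hA : ∀ k, Tendsto (fun x : ℕ × Ω => D.regionBread k x.1 (fun i => O i x.2) (avg x.1 x.2))
      (inProb P) (𝓝 ((D.sensitivity law k θ₀).transpose * D.block (D.variability law θ₀)⁻¹ k k
        * D.sensitivity law k θ₀)) := fun k =>
    ((tendsto_matrix_transpose (hS k)).mul (hW k)).mul (hS k)
  have hH : Tendsto (fun x : ℕ × Ω => D.bread x.1 (fun i => O i x.2) (avg x.1 x.2)) (inProb P)
      (𝓝 (D.asympBread law θ₀)) := tendsto_finsetSum _ fun k _ => hA k
  have hG : Tendsto (fun x : ℕ × Ω => D.meat x.1 (fun i => O i x.2) (avg x.1 x.2)) (inProb P)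
      (𝓝 (D.asympMeat law θ₀)) :=
    tendsto_finsetSum _ fun k _ => tendsto_finsetSum _ fun k' _ =>
      ((((tendsto_matrix_transpose (hS k)).mul (hW k)).mul (hblock hC k k')).mul (hW k')).mul (hS k')
  have hunit := hC1.isUnit_det_asympBread hK hmodel
  have hHinv := tendsto_matrix_inv hH hunit
  have hHunit := eventually_isUnit_det hH hunit
  have hCunit := eventually_isUnit_det hC hC1.isUnit_det_variability
  -- the matrix weights of the regional estimators
  have hL : ∀ k, Tendsto (fun x : ℕ × Ω => Matrix.toEuclideanCLM (n := D.Idx) (𝕜 := ℝ)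
      ((D.bread x.1 (fun i => O i x.2) (avg x.1 x.2))⁻¹ *
        D.regionBread k x.1 (fun i => O i x.2) (avg x.1 x.2))) (inProb P)
      (𝓝 (Matrix.toEuclideanCLM (n := D.Idx) (𝕜 := ℝ)
        (D.scoreWeight law θ₀ k * D.sensitivity law k θ₀))) := fun k => by
    have h1 := (continuous_toEuclideanCLM.tendsto _).comp (hHinv.mul (hA k))
    have h2 : (D.asympBread law θ₀)⁻¹ * ((D.sensitivity law k θ₀).transpose *
        D.block (D.variability law θ₀)⁻¹ k k * D.sensitivity law k θ₀) =
        D.scoreWeight law θ₀ k * D.sensitivity law k θ₀ := by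
      simp only [Design.scoreWeight, Matrix.mul_assoc]
    rwa [h2] at h1
  have hmeta_sub : ∀ᶠ x : ℕ × Ω in inProb P, metaEst x.1 x.2 - θ₀ =
      ∑ k, Matrix.toEuclideanCLM (n := D.Idx) (𝕜 := ℝ)
        ((D.bread x.1 (fun i => O i x.2) (avg x.1 x.2))⁻¹ *
          D.regionBread k x.1 (fun i => O i x.2) (avg x.1 x.2)) (est x.1 k x.2 - θ₀) := by
    filter_upwards [hHunit] with x hx
    rw [hmeta, havg]
    rw [havg] at hx
    exact Design.metaEstimate_sub hx θ₀
  refine ⟨eventually_inProb.1 (hCunit.and hHunit), hunit, hC1.posSemidef_asympCov, ?_, ?_, ?_⟩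
  · rw [tendstoInMeasure_iff_inProb, tendsto_iff_norm_sub_tendsto_zero,
      ← tendsto_zero_iff_norm_tendsto_zero]
    have h1 := tendsto_finsetSum Finset.univ fun k _ =>
      ((isBoundedBilinearMap_apply (𝕜 := ℝ)).continuous.tendsto _).comp
        ((hL k).prodMk_nhds ((hcons k).sub_const θ₀))
    simp only [Function.comp_def, sub_self, map_zero, Finset.sum_const_zero] at h1
    exact h1.congr' (hmeta_sub.mono fun x hx => hx.symm)
  -- The limit law is that of the normalized mean influence; the difference from it must vanish in
  -- probability.
  · refine tendstoInDistribution_of_tendstoInMeasure_sub _ _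
      (tendstoInDistribution_sqrt_smul_mean hindep hlaw hC1.memLp_influence
        hC1.integral_influence hC1.posSemidef_asympCov
        (hC1.integral_inner_influence_sq hmodel)) ?_
      fun n => (measurable_const_smul _).comp_aemeasurable ((hmeta_meas n).sub_const θ₀)
    refine tendstoInMeasure_iff_inProb (a := (0 : D.Param)).2 ?_
    -- First part of the difference: random weights replaced by their limits, an `o_p(1)` operator
    -- applied to an `O_p(1)` error.
    have h1 : ∀ k, Tendsto (fun x : ℕ × Ω => (Matrix.toEuclideanCLM (n := D.Idx) (𝕜 := ℝ)
        ((D.bread x.1 (fun i => O i x.2) (avg x.1 x.2))⁻¹ *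
          D.regionBread k x.1 (fun i => O i x.2) (avg x.1 x.2)) -
        Matrix.toEuclideanCLM (n := D.Idx) (𝕜 := ℝ)
        (D.scoreWeight law θ₀ k * D.sensitivity law k θ₀)) (√(x.1 : ℝ) • (est x.1 k x.2 - θ₀)))
        (inProb P) (𝓝 0) := fun k => by
      have h2 := tendsto_iff_norm_sub_tendsto_zero.1 (hL k)
      refine TightEvents.tendsto_zero_of_norm_le
        (X := fun x => √(x.1 : ℝ) * ‖est x.1 k x.2 - θ₀‖) ?_ h2
        (Eventually.of_forall fun x => ?_)
      · refine (hrate k).mono fun M => ⟨M, Eventually.of_forall fun x hx => ?_⟩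
        rwa [abs_of_nonneg (by positivity)]
      · refine (ContinuousLinearMap.le_opNorm _ _).trans_eq ?_
        rw [norm_smul, Real.norm_of_nonneg (Real.sqrt_nonneg _), abs_norm,
          abs_of_nonneg (by positivity), mul_comm]
    -- Second part: the linearization of the regional score equation under the fixed limit weight.
    have h2 : ∀ k, Tendsto (fun x : ℕ × Ω => Matrix.toEuclideanCLM (n := D.Idx) (𝕜 := ℝ)
        (D.scoreWeight law θ₀ k) (√(x.1 : ℝ) • (D.expectedDeriv law θ₀ k (est x.1 k x.2 - θ₀) +
        D.meanScore k x.1 (fun i => O i x.2) θ₀))) (inProb P) (𝓝 0) := fun k => by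
      have h3 := ((Matrix.toEuclideanCLM (n := D.Idx) (𝕜 := ℝ)
        (D.scoreWeight law θ₀ k)).continuous.tendsto 0).comp (hlin k)
      rwa [map_zero] at h3
    have h3 := tendsto_finsetSum Finset.univ fun k _ => (h1 k).add (h2 k)
    simp only [add_zero, Finset.sum_const_zero] at h3
    refine h3.congr' ?_
    filter_upwards [hmeta_sub] with x hx
    simp only [Pi.sub_apply]
    rw [hx, Design.mean_influence, smul_neg, sub_neg_eq_add, Finset.smul_sum, Finset.smul_sum,
      ← Finset.sum_add_distrib]
    refine Finset.sum_congr rfl fun k _ => ?_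
    -- Factoring the limit weight as score weight times `A_k` makes the `A_k (θ̂_k - θ₀)` terms of
    -- the two parts cancel.
    rw [map_mul _ (D.scoreWeight law θ₀ k), hC1.toEuclideanCLM_sensitivity]
    rw [sub_apply, mul_apply_eq_comp]
    simp only [map_smul, map_add]
    module
  · intro a b
    rw [tendstoInMeasure_iff_inProb]
    have h1 := (hHinv.mul hG).mul (tendsto_matrix_inv (tendsto_matrix_transpose hH)
      (by rwa [Matrix.det_transpose]))
    refine (tendsto_pi_nhds.1 (tendsto_pi_nhds.1 h1 a) b).congr' ?_
    filter_upwards [tendsto_fst_inProb.eventually_ge_atTop 1] with x hx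
    have hn : (x.1 : ℝ) ≠ 0 := by positivity
    rw [Design.covEstimate, Matrix.smul_apply, smul_eq_mul, mul_inv_cancel_left₀ hn]
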